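/- Let $0<t<1$, let $M,N\ge 1$ be integers, and let $\varphi(z)=(1+tz)^M(1+t/z)^N$. Let $\Sigma=\{|z|=1\}$ be oriented counter-clockwise and, for an integer $k\ge 0$, consider the Riemann–Hilbert problem for a $2\times2$ matrix function $Y(z)=Y(z;k)$: (i) $Y$ is analytic in $\mathbb C\setminus\Sigma$ and continuous up to the boundary from each side; (ii) $Y_+(z)=Y_-(z)\begin{pmatrix}1& z^{-k}\varphi(z)\\0&1\end{pmatrix}$ for $z\in\Sigma$, where $Y_+$ and $Y_-$ are the boundary values from inside and outside the circle; (iii) $Y(z)\begin{pmatrix}z^{-k}&0\\0&z^{k}\end{pmatrix}=I+O(1/z)$ as $z\to\infty$. Then: (a) For every $k\ge 0$ the solution exists and is unique (as a function on $\mathbb C\setminus\Sigma$). (b) Let $\varphi_j=\int_{|z|=1}z^{-j}\varphi(z)\frac{dz}{2\pi i z}$ and $D_n=\det(\varphi_{j-k})_{0\le j,k<n}$ (with $D_0=1$). Then $D_n\ne0$ for all $n\ge0$. Put $N_k=D_{k+1}/D_k$ and let $$\pi_k(z)=\frac1{D_k}\det\begin{pmatrix}\varphi_0&\varphi_{-1}&\cdots&\varphi_{-k}\\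 \vdots&\vdots&&\vdots\\ \varphi_{k-1}&\varphi_{k-2}&\cdots&\varphi_{-1}\\1&z&\cdots&z^k\end{pmatrix},\qquad \pi_k^*(z)=\frac1{D_k}\det\begin{pmatrix}\varphi_0&\varphi_{1}&\cdots&\varphi_{k}\\ \vdots&\vdots&&\vdots\\ \varphi_{-k+1}&\varphi_{-k+2}&\cdots&\varphi_{1}\\z^k&z^{k-1}&\cdots&1\end{pmatrix}.$$ For $0\le j\le k$ these satisfy $\int_{|z|=1}z^{-j}\pi_k(z)\varphi(z)\frac{dz}{2\pi iz}=N_k\delta_{jk}$ and $\int_{|z|=1}z^{-j}\pi^*_k(z)\varphi(z)\frac{dz}{2\pi iz}=N_k\delta_{j0}$. With $(Ch)(z)=\frac1{2\pi i}\int_\Sigma\frac{h(s)}{s-z}\,ds$, the solution for $k\ge1$ is $$Y(z;k)=\begin{pmatrix}\pi_k(z)&C\big((\cdot)^{-k}\varphi\,\pi_k\big)(z)\\-N_{k-1}^{-1}\pi^*_{k-1}(z)&-N_{k-1}^{-1}C\big((\cdot)^{-k}\varphi\,\pi^*_{k-1}\big)(z)\end{pmatrix}.$$ (c) Let $w(i,j)$,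 $i,j\ge1$, be independent random variables with $\mathbb P(w(i,j)=m)=(1-t^2)(t^2)^m$ for $m=0,1,2,\dots$, and let $G(M,N)$ be the maximum of $\sum_{(i,j)\in\pi}w(i,j)$ over all up/right lattice paths $\pi$ from $(1,1)$ to $(M,N)$ (each step is $(1,0)$ or $(0,1)$, and both endpoints belong to the path). Then for every integer $n\ge0$ the following infinite product converges and $$\mathbb P\big(G(M,N)\le n\big)=\prod_{k=n}^\infty\big(-Y_{21}(0;k+1)\big).$$ -/

import Mathlib

open Filter Asymptotics MeasureTheory ProbabilityTheory

noncomputable section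

namespace LastPassage

/-- `π` is (the set of sites of) an up/right path from `(1,1)` to `(M,N)`: its sites can be
listed as `s 1, …, s (M + N - 1)`, starting at `(1,1)`, ending at `(M,N)`, every step
being `(1,0)` or `(0,1)`. -/
def IsUpRightPath (M N : ℕ) (π : Finset (ℕ × ℕ)) : Prop :=
  ∃ s : ℕ → ℕ × ℕ,
    s 1 = (1, 1) ∧ s (M + N - 1) = (M, N) ∧
    (∀ k, 1 ≤ k → k < M + N - 1 → s (k + 1) = s k + (1, 0) ∨ s (k + 1) = s k + (0, 1)) ∧
    π = (Finset.Icc 1 (M + N - 1)).image s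

open Classical in
/-- The finite set of all up/right paths from `(1,1)` to `(M,N)`. Such a path stays in the
rectangle `[1,M] × [1,N]`, so the ambient powerset excludes nothing. -/
def upRightPaths (M N : ℕ) : Finset (Finset (ℕ × ℕ)) :=
  ((Finset.Icc 1 M ×ˢ Finset.Icc 1 N).powerset).filter (IsUpRightPath M N)

/-- The last passage time `G(M,N)`: the maximal weight of an up/right path from `(1,1)` to
`(M,N)`, where the site `p` has weight `w p`. -/
def G (w : ℕ × ℕ → ℕ) (M N : ℕ) : ℕ :=
  (upRightPaths M N).sup fun π => ∑ p ∈ π, w p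

/-- The sites `(i,j)` with `i, j ≥ 1`. -/
abbrev Site : Type := {p : ℕ × ℕ // 1 ≤ p.1 ∧ 1 ≤ p.2}

/-- The weights at the sites `(i,j)`, `i, j ≥ 1`, are independent geometric random variables,
`ℙ(w(i,j) = m) = (1 - t²) (t²)^m` for `m = 0, 1, 2, …`. Nothing is asked of `w` elsewhere. -/
structure IsGeometricEnvironment {Ω : Type*} [MeasurableSpace Ω] (μ : Measure Ω) (t : ℝ)
    (w : ℕ × ℕ → Ω → ℕ) : Prop where
  measurable : ∀ p : Site, Measurable (w p)
  indep : iIndepFun (fun p : Site => w p) μ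
  law : ∀ (p : Site) (m : ℕ), μ.real {ω | w p ω = m} = (1 - t ^ 2) * (t ^ 2) ^ m

end LastPassage

namespace CircleRHP

/-- The weight `φ(z) = (1 + t z)^M (1 + t / z)^N`. -/
def phi (t : ℝ) (M N : ℕ) (z : ℂ) : ℂ :=
  (1 + (t : ℂ) * z) ^ M * (1 + (t : ℂ) / z) ^ N

/-- The mean `∫_{|z|=1} f(z) dz / (2πiz)` over the unit circle. -/
def circleMean (f : ℂ → ℂ) : ℂ :=
  (2 * (Real.pi : ℂ) * Complex.I)⁻¹ * ∮ z in C(0, 1), f z / z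

/-- The Fourier coefficient `φ_j = ∫_{|z|=1} z^{-j} φ(z) dz / (2πiz)`. -/
def fourierCoeff (t : ℝ) (M N : ℕ) (j : ℤ) : ℂ :=
  circleMean fun z => z ^ (-j) * phi t M N z

/-- The Toeplitz determinant `D_n = det (φ_{j-k})_{0 ≤ j, k < n}`. -/
def toeplitzDet (t : ℝ) (M N n : ℕ) : ℂ :=
  (Matrix.of fun j k : Fin n => fourierCoeff t M N ((j : ℤ) - (k : ℤ))).det

/-- `N_k = D_{k+1} / D_k`. -/
def normConst (t : ℝ) (M N k : ℕ) : ℂ :=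
  toeplitzDet t M N (k + 1) / toeplitzDet t M N k

/-- `π_k(z) = D_k⁻¹ det A`, where row `r < k` of the `(k+1) × (k+1)` matrix `A` is
`(φ_r, φ_{r-1}, …, φ_{r-k})` and its last row is `(1, z, …, z^k)`. -/
def orthPoly (t : ℝ) (M N k : ℕ) (z : ℂ) : ℂ :=
  (toeplitzDet t M N k)⁻¹ *
    (Matrix.of fun r c : Fin (k + 1) =>
      if (r : ℕ) < k then fourierCoeff t M N ((r : ℤ) - (c : ℤ)) else z ^ (c : ℕ)).det

/-- `π*_k(z) = D_k⁻¹ det B`, where row `r < k` of the `(k+1) × (k+1)` matrix `B` is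
`(φ_{-r}, φ_{1-r}, …, φ_{k-r})` and its last row is `(z^k, z^{k-1}, …, 1)`. -/
def orthPolyStar (t : ℝ) (M N k : ℕ) (z : ℂ) : ℂ :=
  (toeplitzDet t M N k)⁻¹ *
    (Matrix.of fun r c : Fin (k + 1) =>
      if (r : ℕ) < k then fourierCoeff t M N ((c : ℤ) - (r : ℤ)) else z ^ (k - (c : ℕ))).det

/-- The Cauchy transform `(C h)(z) = (2πi)⁻¹ ∫_{|s|=1} h(s) / (s - z) ds`, for `|z| ≠ 1`. -/
def cauchyTransform (h : ℂ → ℂ) (z : ℂ) : ℂ :=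
  (2 * (Real.pi : ℂ) * Complex.I)⁻¹ * ∮ s in C(0, 1), h s / (s - z)

/-- The matrix built from the orthogonal polynomials, for `k ≥ 1` and `|z| ≠ 1`. -/
def orthMatrix (t : ℝ) (M N k : ℕ) (z : ℂ) : Matrix (Fin 2) (Fin 2) ℂ :=
  !![orthPoly t M N k z,
      cauchyTransform (fun s => s ^ (-(k : ℤ)) * phi t M N s * orthPoly t M N k s) z;
    -(normConst t M N (k - 1))⁻¹ * orthPolyStar t M N (k - 1) z,
      -(normConst t M N (k - 1))⁻¹ *
        cauchyTransform (fun s => s ^ (-(k : ℤ)) * phi t M N s * orthPolyStar t M N (k - 1) s) z]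

/-- The complement `ℂ ∖ Σ` of the unit circle. -/
def offCircle : Set ℂ := {z | ‖z‖ ≠ 1}

/-- `Y` solves the Riemann–Hilbert problem on the unit circle. Only the values of `Y` off the
circle matter. `Yin` and `Yout` are the continuous extensions of `Y` to the closed disc and
to the closed exterior; on the circle they are the boundary values `Y₊` (from inside) and
`Y₋` (from outside). -/
structure IsSolution (t : ℝ) (M N k : ℕ) (Y : ℂ → Matrix (Fin 2) (Fin 2) ℂ) : Prop where
  analytic : ∀ i j, AnalyticOnNhd ℂ (fun z => Y z i j) offCircle
  jump : ∃ Yin Yout : ℂ → Matrix (Fin 2) (Fin 2) ℂ,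
    ContinuousOn Yin {z | ‖z‖ ≤ 1} ∧ Set.EqOn Yin Y {z | ‖z‖ < 1} ∧
    ContinuousOn Yout {z | 1 ≤ ‖z‖} ∧ Set.EqOn Yout Y {z | 1 < ‖z‖} ∧
    ∀ z : ℂ, ‖z‖ = 1 → Yin z = Yout z * !![1, z ^ (-(k : ℤ)) * phi t M N z; 0, 1]
  normalized : ∀ i j,
    (fun z : ℂ => (Y z * !![z ^ (-(k : ℤ)), 0; 0, z ^ (k : ℤ)] - 1) i j)
      =O[Bornology.cobounded ℂ] fun z : ℂ => z⁻¹

end CircleRHP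

end

/-! The three claims meet in one identity: with `D_n` the Toeplitz determinant of `φ`, `ℙ(G ≤ n) =
(1 - t²)^(MN) D_n`.

Probability side. An `M × N` matrix of weights is sent to a growth diagram of partitions. Its local
rule is a bijection compatible with sizes (`tsum_grow`), and on first rows it is the recursion
`max(left, below) + w` of last passage times. Summing `(t²)^(sum of entries)` over the matrices with
`G ≤ n` therefore gives Cauchy's sum of products of two Schur functions, in `N` and in `M` variables
all equal to `t`, over partitions with first row at most `n` (`tsum_growMatrix_top`). The sums live
in `ℝ≥0∞`, so no summability has to be checked.

Determinant side. Multiplying the symbol by `1 + x T^d` expands a Toeplitz minor, row by row, into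
minors with some rows shifted; minors outside the set of shapes vanish. Starting from the empty
shape, the factors of `φ` build the same sum, written with column heights (`det_toeplitz_eq_finsum`,
Gessel's identity). Conjugation of partitions matches the two sums (`schur_eq_stripSum`). The empty
partition alone contributes at least `1`, so `D_n ≠ 0`.

Riemann–Hilbert side. For two solutions, `Y' adj(Y)` has no jump and tends to `I`, hence is `I`;
this is uniqueness. For existence, everything is a Laurent polynomial: the Cauchy transform is the
projection on nonnegative degrees inside the circle and minus the projection on negative degrees
outside. The jump relation becomes "a Laurent polynomial is the sum of its two parts", and the
normalization at infinity becomes the orthogonality relations.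

Conclusion. As `π*_k(0) = 1`, uniqueness gives `-Y₂₁(0; k+1) = 1 / N_k = D_k / D_{k+1}`. This is a
ratio of consecutive values of the distribution function of `G`; the product telescopes, and the
distribution function tends to `1`. -/

noncomputable section

/-! ### Growth diagrams and the Cauchy identity refined by the first row. -/

namespace LastPassage

open scoped ENNReal

/-- An integer partition, given by its weakly decreasing sequence of rows. -/
@[ext]
structure Ptn where
  row : ℕ → ℕ
  anti : Antitone row
  vanish : ∃ R, row R = 0

namespace Ptn

/-- The empty partition. -/
def empty : Ptn := ⟨fun _ => 0, fun _ _ _ => le_rfl, 0, rfl⟩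

/-- The number of nonzero rows. -/
def length (l : Ptn) : ℕ := Nat.find l.vanish

/-- The number of boxes. -/
def size (l : Ptn) : ℕ := ∑ i ∈ Finset.range l.length, l.row i

theorem row_eq_zero_of_le (l : Ptn) {R S : ℕ} (h : l.row R = 0) (hRS : R ≤ S) :
    l.row S = 0 :=
  Nat.le_zero.mp (h ▸ l.anti hRS)

theorem size_eq (l : Ptn) {R : ℕ} (h : l.row R = 0) :
    l.size = ∑ i ∈ Finset.range R, l.row i := by
  refine Finset.sum_subset
    (Finset.range_subset_range.mpr (Nat.find_min' l.vanish h)) fun i _ hi => ?_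
  exact l.row_eq_zero_of_le (Nat.find_spec l.vanish) (by simpa [length] using hi)

theorem exists_common_zero (k l m : Ptn) :
    ∃ R, k.row R = 0 ∧ l.row R = 0 ∧ m.row R = 0 := by
  obtain ⟨a, ha⟩ := k.vanish
  obtain ⟨b, hb⟩ := l.vanish
  obtain ⟨c, hc⟩ := m.vanish
  exact ⟨a + b + c, k.row_eq_zero_of_le ha (by omega), l.row_eq_zero_of_le hb (by omega),
    m.row_eq_zero_of_le hc (by omega)⟩

@[simp] theorem empty_row (i : ℕ) : empty.row i = 0 := rfl

@[simp] theorem size_empty : empty.size = 0 := by simp [size]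

/-- `l / k` is a horizontal strip. -/
def Interlace (k l : Ptn) : Prop := ∀ i, l.row (i + 1) ≤ k.row i ∧ k.row i ≤ l.row i

theorem Interlace.size_le {k l : Ptn} (h : Interlace k l) : k.size ≤ l.size := by
  obtain ⟨R, h1, h2, -⟩ := exists_common_zero k l l
  rw [k.size_eq h1, l.size_eq h2]
  exact Finset.sum_le_sum fun i _ => (h i).2

theorem interlace_empty_iff {k : Ptn} : Interlace k empty ↔ k = empty := by
  refine ⟨fun h => Ptn.ext (funext fun i => Nat.le_zero.mp (h i).2), ?_⟩
  rintro rfl i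
  simp

/-- The rows prescribed by the local rule of a growth diagram, before they are known to be
decreasing. -/
def growRow (k m v : Ptn) (w : ℕ) : ℕ → ℕ
  | 0 => max (m.row 0) (v.row 0) + w
  | i + 1 => max (m.row (i + 1)) (v.row (i + 1)) + (min (m.row i) (v.row i) - k.row i)

/-- The local rule of a growth diagram. The running minimum makes it total; it has no effect
when `k` interlaces with `m` and `v`. -/
def grow (k m v : Ptn) (w : ℕ) : Ptn where
  row i := (Finset.range (i + 1)).inf' ⟨0, by simp⟩ (growRow k m v w)
  anti i j hij := Finset.inf'_mono _ (Finset.range_subset_range.mpr (by omega)) _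
  vanish := by
    obtain ⟨R, -, h1, h2⟩ := exists_common_zero k m v
    refine ⟨R + 1, Nat.le_zero.mp ?_⟩
    refine (Finset.inf'_le _ (b := R + 1) (by simp)).trans ?_
    simp [growRow, h1, m.row_eq_zero_of_le h1 (Nat.le_succ R),
      v.row_eq_zero_of_le h2 (Nat.le_succ R)]

/-- Over the single index `0` the running minimum is trivial, so no interlacing is needed. First
rows can thus be followed through a diagram without carrying interlacing hypotheses. -/
theorem grow_row_zero (k m v : Ptn) (w : ℕ) :
    (grow k m v w).row 0 = max (m.row 0) (v.row 0) + w := by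
  simp [grow, growRow]

/-- Interlacing gives `max (m_{i+1}) (v_{i+1}) ≤ k_i ≤ min (m_i) (v_i)`, so entry `i + 1` of
`growRow` is at most `min (m_i) (v_i)`, while entry `i` is at least `max (m_i) (v_i)`. -/
theorem grow_row {k m v : Ptn} (hm : Interlace k m) (hv : Interlace k v) (w i : ℕ) :
    (grow k m v w).row i = growRow k m v w i := by
  have anti : Antitone (growRow k m v w) := by
    refine antitone_nat_of_succ_le fun i => ?_
    have h1 := hm i
    have h2 := hv i
    rcases i with _ | i
    · simp only [growRow]; omega
    · have h3 := hm (i + 1)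
      simp only [growRow]; omega
  refine le_antisymm (Finset.inf'_le _ (by simp)) ?_
  refine (Finset.le_inf'_iff ⟨0, by simp⟩ (growRow k m v w)).mpr fun j hj => anti ?_
  exact Nat.lt_succ_iff.mp (Finset.mem_range.mp hj)

theorem interlace_grow_left {k m v : Ptn} (hm : Interlace k m) (hv : Interlace k v) (w : ℕ) :
    Interlace m (grow k m v w) := by
  intro i
  rw [grow_row hm hv, grow_row hm hv]
  have h1 := hm i
  have h2 := hv i
  rcases i with _ | i
  · simp only [growRow]; omega
  · simp only [growRow]; omega

theorem interlace_grow_right {k m v : Ptn} (hm : Interlace k m) (hv : Interlace k v) (w : ℕ) :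
    Interlace v (grow k m v w) := by
  intro i
  rw [grow_row hm hv, grow_row hm hv]
  have h1 := hm i
  have h2 := hv i
  rcases i with _ | i
  · simp only [growRow]; omega
  · simp only [growRow]; omega

theorem size_grow {k m v : Ptn} (hm : Interlace k m) (hv : Interlace k v) (w : ℕ) :
    (grow k m v w).size + k.size = m.size + v.size + w := by
  obtain ⟨R, h0, h1, h2⟩ := exists_common_zero k m v
  have hz : (grow k m v w).row (R + 1) = 0 := by
    rw [grow_row hm hv]
    simp [growRow, h1, m.row_eq_zero_of_le h1 (Nat.le_succ R),
      v.row_eq_zero_of_le h2 (Nat.le_succ R)]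
  rw [size_eq _ hz, size_eq _ h0, size_eq m (m.row_eq_zero_of_le h1 (Nat.le_succ R)),
    size_eq v (v.row_eq_zero_of_le h2 (Nat.le_succ R))]
  simp only [grow_row hm hv]
  clear hz h0
  -- Since `max + min` is the sum, the partial sums balance up to the minimum of row `S`, which is
  -- only used by the next row; it vanishes at `S = R`.
  have key : ∀ S, ∑ i ∈ Finset.range (S + 1), growRow k m v w i
      + ∑ i ∈ Finset.range S, k.row i + min (m.row S) (v.row S)
      = ∑ i ∈ Finset.range (S + 1), m.row i + ∑ i ∈ Finset.range (S + 1), v.row i + w := by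
    intro S
    induction S with
    | zero => simp [growRow]; omega
    | succ S ih =>
      rw [Finset.sum_range_succ, Finset.sum_range_succ (fun i => k.row i),
        Finset.sum_range_succ (fun i => m.row i) (S + 1),
        Finset.sum_range_succ (fun i => v.row i) (S + 1)]
      have h1 := hm S
      have h2 := hv S
      have h3 : growRow k m v w (S + 1) = max (m.row (S + 1)) (v.row (S + 1)) +
        (min (m.row S) (v.row S) - k.row S) := rfl
      omega
  have := key R
  simpa [h1] using this

/-- The inverse of the local rule: the inner partition. -/
def shrink (m v r : Ptn) (hm : Interlace m r) (hv : Interlace v r) : Ptn where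
  row i := min (m.row i) (v.row i) - (r.row (i + 1) - max (m.row (i + 1)) (v.row (i + 1)))
  anti := by
    refine antitone_nat_of_succ_le fun i => ?_
    have h1 := hm i
    have h2 := hv i
    have h3 := hm (i + 1)
    have h4 := hv (i + 1)
    omega
  vanish := by
    obtain ⟨R, h, -, -⟩ := exists_common_zero m m m
    exact ⟨R, by simp [h]⟩

theorem interlace_shrink_left {m v r : Ptn} (hm : Interlace m r) (hv : Interlace v r) :
    Interlace (shrink m v r hm hv) m := by
  intro i
  have h1 := hm i
  have h2 := hv i
  have h3 := m.anti (Nat.le_succ i)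
  have h4 := hm (i + 1)
  have h5 := hv (i + 1)
  simp only [shrink]
  omega

theorem interlace_shrink_right {m v r : Ptn} (hm : Interlace m r) (hv : Interlace v r) :
    Interlace (shrink m v r hm hv) v := by
  intro i
  have h1 := hm i
  have h2 := hv i
  have h4 := hm (i + 1)
  have h5 := hv (i + 1)
  simp only [shrink]
  omega

theorem grow_shrink {m v r : Ptn} (hm : Interlace m r) (hv : Interlace v r) :
    grow (shrink m v r hm hv) m v (r.row 0 - max (m.row 0) (v.row 0)) = r := by
  ext i
  rw [grow_row (interlace_shrink_left hm hv) (interlace_shrink_right hm hv)]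
  rcases i with _ | i
  · have h1 := hm 0
    have h2 := hv 0
    simp only [growRow]
    omega
  · have h1 := hm i
    have h2 := hv i
    have h4 := hm (i + 1)
    have h5 := hv (i + 1)
    simp only [growRow, shrink]
    omega

/-- Row `0` determines `w`, and row `i + 1` determines `k_i` because the truncated subtraction `min
(m_i) (v_i) - k_i` is a true one. -/
theorem grow_injective {k k' m v : Ptn} {w w' : ℕ} (hm : Interlace k m) (hv : Interlace k v)
    (hm' : Interlace k' m) (hv' : Interlace k' v) (h : grow k m v w = grow k' m v w') :
    k = k' ∧ w = w' := by
  have key : ∀ i, growRow k m v w i = growRow k' m v w' i := fun i => by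
    rw [← grow_row hm hv, ← grow_row hm' hv', h]
  constructor
  · ext i
    have h1 := hm i
    have h2 := hv i
    have h3 := hm' i
    have h4 := hv' i
    have h5 := key (i + 1)
    simp only [growRow] at h5
    omega
  · have h5 := key 0
    simp only [growRow] at h5
    omega

end Ptn

open Ptn

open Classical in
/-- The indicator of a proposition. -/
def ind (p : Prop) : ℝ≥0∞ := if p then 1 else 0

theorem ind_true {p : Prop} (h : p) : ind p = 1 := if_pos h

theorem ind_false {p : Prop} (h : ¬p) : ind p = 0 := if_neg h

theorem of_ind_ne_zero {p : Prop} (h : ind p ≠ 0) : p := by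
  by_contra hp
  exact h (ind_false hp)

/-- For fixed `m` and `v`, the local rule is a bijection from pairs `(k, w)` to outer partitions
`r`, with inverse `shrink`. By `size_grow` the weights agree: `|m| - |k| + w = |r| - |v|`. -/
theorem tsum_grow (q : ℝ≥0∞) (m v : Ptn) (H : Ptn → ℝ≥0∞) :
    ∑' k, ∑' w, ind (Interlace k m) * ind (Interlace k v) * q ^ (m.size - k.size) * q ^ w *
        H (grow k m v w) =
      ∑' r, ind (Interlace m r) * ind (Interlace v r) * q ^ (r.size - v.size) * H r := by
  rw [← ENNReal.tsum_prod]
  symm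
  have hI : ∀ x : Function.support (fun x : Ptn × ℕ => ind (Interlace x.1 m) *
      ind (Interlace x.1 v) * q ^ (m.size - x.1.size) * q ^ x.2 * H (grow x.1 m v x.2)),
      Interlace x.1.1 m ∧ Interlace x.1.1 v := by
    rintro ⟨x, hx⟩
    simp only [Function.mem_support, ne_eq, mul_eq_zero, not_or] at hx
    exact ⟨of_ind_ne_zero hx.1.1.1.1, of_ind_ne_zero hx.1.1.1.2⟩
  refine tsum_eq_tsum_of_ne_zero_bij (fun x => grow x.1.1 m v x.1.2) ?_ ?_ ?_
  · intro x y hxy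
    have := grow_injective (hI x).1 (hI x).2 (hI y).1 (hI y).2 hxy
    exact Subtype.ext (Prod.ext this.1 this.2)
  · intro r hr
    simp only [Function.mem_support, ne_eq, mul_eq_zero, not_or] at hr
    have hm := of_ind_ne_zero hr.1.1.1
    have hv := of_ind_ne_zero hr.1.1.2
    have hg := grow_shrink hm hv
    have h1 := interlace_shrink_left hm hv
    have h2 := interlace_shrink_right hm hv
    refine ⟨⟨(shrink m v r hm hv, r.row 0 - max (m.row 0) (v.row 0)), ?_⟩, hg⟩
    have hs := size_grow h1 h2 (r.row 0 - max (m.row 0) (v.row 0))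
    rw [hg] at hs
    simp only [Function.mem_support, hg, ind_true h1, ind_true h2, one_mul, ← pow_add]
    refine mul_ne_zero ?_ hr.2
    convert hr.1.2 using 3
    have := h1.size_le
    have := hv.size_le
    omega
  · intro x
    obtain ⟨h1, h2⟩ := hI x
    have hs := size_grow h1 h2 x.1.2
    have := h1.size_le
    have h3 := interlace_grow_left h1 h2 x.1.2
    have h4 := interlace_grow_right h1 h2 x.1.2
    have := h4.size_le
    simp only [ind_true h1, ind_true h2, ind_true h3, ind_true h4, one_mul, ← pow_add]
    congr 2
    omega

theorem tsum_of_unique {β : Type*} [Unique β] (f : β → ℝ≥0∞) : ∑' x, f x = f default :=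
  tsum_eq_single default fun x hx => (hx (Unique.eq_default x)).elim

theorem tsum_snoc {X : Type*} (N : ℕ) (F : (Fin (N + 1) → X) → ℝ≥0∞) :
    ∑' f, F f = ∑' f : Fin N → X, ∑' x, F (Fin.snoc f x) := by
  rw [← (Fin.snocEquiv fun _ : Fin (N + 1) => X).tsum_eq, ENNReal.tsum_comm]
  exact ENNReal.tsum_prod (f := fun x f => F (Fin.snoc f x))

/-- The last partition of a chain, empty if there is none. -/
def top : {N : ℕ} → (Fin N → Ptn) → Ptn
  | 0, _ => Ptn.empty
  | N + 1, b => b (Fin.last N)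

/-- The indicator of the chains `∅ ≺ b 0 ≺ b 1 ≺ …`. -/
def chainInd : {N : ℕ} → (Fin N → Ptn) → ℝ≥0∞
  | 0, _ => 1
  | N + 1, b => chainInd (fun i : Fin N => b i.castSucc) *
      ind (Interlace (top fun i : Fin N => b i.castSucc) (b (Fin.last N)))

/-- One column of a growth diagram. -/
def growColumn : {N : ℕ} → (Fin N → Ptn) → (Fin N → ℕ) → Fin N → Ptn
  | 0, _, _ => Fin.elim0
  | N + 1, a, w =>
    Fin.snoc (growColumn (fun i : Fin N => a i.castSucc) fun i => w i.castSucc)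
      (grow (top fun i : Fin N => a i.castSucc)
        (top (growColumn (fun i : Fin N => a i.castSucc) fun i => w i.castSucc))
        (a (Fin.last N)) (w (Fin.last N)))

@[simp] theorem top_snoc {N : ℕ} (b : Fin N → Ptn) (l : Ptn) :
    top (Fin.snoc b l : Fin (N + 1) → Ptn) = l := by
  simp [top]

theorem chainInd_snoc {N : ℕ} (b : Fin N → Ptn) (l : Ptn) :
    chainInd (Fin.snoc b l : Fin (N + 1) → Ptn) = chainInd b * ind (Interlace (top b) l) := by
  simp [chainInd]

theorem growColumn_snoc {N : ℕ} (a : Fin N → Ptn) (l : Ptn) (w : Fin N → ℕ) (x : ℕ) :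
    growColumn (Fin.snoc a l : Fin (N + 1) → Ptn) (Fin.snoc w x : Fin (N + 1) → ℕ) =
      Fin.snoc (growColumn a w) (grow (top a) (top (growColumn a w)) l x) := by
  simp [growColumn]

/-- The local bijection applied box by box up a column: the old chain is summed out except for its
top `k`, which stays attached to the new chain by one horizontal strip. -/
theorem tsum_growColumn (q : ℝ≥0∞) (N : ℕ) (h : Ptn → (Fin N → Ptn) → ℝ≥0∞) :
    ∑' a : Fin N → Ptn, ∑' w : Fin N → ℕ,
        chainInd a * q ^ (∑ i, w i) * h (top a) (growColumn a w) =
      ∑' b : Fin N → Ptn, ∑' k, chainInd b * ind (Interlace k (top b)) *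
        q ^ ((top b).size - k.size) * h k b := by
  induction N with
  | zero =>
    rw [tsum_of_unique (β := Fin 0 → Ptn), tsum_of_unique (β := Fin 0 → Ptn),
      tsum_of_unique (β := Fin 0 → ℕ),
      tsum_eq_single Ptn.empty (fun k hk => by
        simp [top, ind_false (fun h => hk (interlace_empty_iff.mp h))])]
    simp only [top, ind_true (interlace_empty_iff.mpr rfl)]
    simp only [Finset.univ_eq_empty, Finset.sum_empty, pow_zero, mul_one, tsub_self]
    exact congrArg (fun b => chainInd default * h _ b) (Subsingleton.elim _ _)
  | succ N ih =>
    simp only [tsum_snoc N, chainInd_snoc, growColumn_snoc, top_snoc, Fin.sum_univ_castSucc,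
      Fin.snoc_castSucc, Fin.snoc_last]
    -- The test function already contains the sums over the new box: its upper left corner `l` and
    -- its weight `x`. This is why `h` must be arbitrary in the induction.
    have key := ih fun k b => ∑' l, ∑' x, ind (Interlace k l) * q ^ x *
      h l (Fin.snoc b (grow k (top b) l x))
    refine Eq.trans ?_ (key.trans ?_)
    · refine tsum_congr fun a => ?_
      rw [ENNReal.tsum_comm]
      refine tsum_congr fun w => ?_
      rw [← ENNReal.tsum_mul_left]
      refine tsum_congr fun l => ?_
      rw [← ENNReal.tsum_mul_left]
      refine tsum_congr fun x => ?_
      rw [pow_add]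
      ring
    · refine tsum_congr fun b => ?_
      simp only [← ENNReal.tsum_mul_left]
      rw [ENNReal.tsum_comm]
      conv_rhs => rw [ENNReal.tsum_comm]
      refine tsum_congr fun l => ?_
      have loc := tsum_grow q (top b) l fun r => chainInd b * h l (Fin.snoc b r)
      refine Eq.trans ?_ (loc.trans ?_)
      · exact tsum_congr fun k => tsum_congr fun x => by ring
      · exact tsum_congr fun r => by ring

/-- The last column of the growth diagram of a matrix. -/
def growMatrix : {M N : ℕ} → (Fin M → Fin N → ℕ) → Fin N → Ptn
  | 0, _, _ => fun _ => Ptn.empty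
  | M + 1, _, A => growColumn (growMatrix fun i : Fin M => A i.castSucc) (A (Fin.last M))

/-- The Schur function `s_l(x, …, x)` of `N` equal variables, as a sum over chains. -/
def schur (x : ℝ≥0∞) : ℕ → Ptn → ℝ≥0∞
  | 0, l => ind (l = Ptn.empty)
  | N + 1, l => ∑' k, ind (Interlace k l) * x ^ (l.size - k.size) * schur x N k

theorem tsum_chain (x : ℝ≥0∞) (N : ℕ) (f : Ptn → ℝ≥0∞) :
    ∑' b : Fin N → Ptn, chainInd b * x ^ (top b).size * f (top b) =
      ∑' l, schur x N l * f l := by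
  induction N generalizing f with
  | zero =>
    rw [tsum_of_unique (β := Fin 0 → Ptn), tsum_eq_single Ptn.empty (fun l hl => by
      simp [schur, ind_false hl])]
    simp [schur, ind_true, top, chainInd]
  | succ N ih =>
    simp only [tsum_snoc N, chainInd_snoc, top_snoc]
    refine Eq.trans ?_ ((ih fun k => ∑' l, ind (Interlace k l) * x ^ (l.size - k.size) *
      f l).trans ?_)
    · refine tsum_congr fun b => ?_
      rw [← ENNReal.tsum_mul_left]
      refine tsum_congr fun l => ?_
      by_cases h : Interlace (top b) l
      · rw [← Nat.add_sub_cancel' h.size_le, pow_add, Nat.add_sub_cancel_left]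
        ring
      · simp [ind_false h]
    · simp only [← ENNReal.tsum_mul_left]
      rw [ENNReal.tsum_comm]
      refine tsum_congr fun l => ?_
      rw [schur, ← ENNReal.tsum_mul_right]
      exact tsum_congr fun k => by ring

theorem eq_empty_of_chainInd_ne_zero {N : ℕ} (b : Fin N → Ptn) (hb : chainInd b ≠ 0)
    (ht : top b = Ptn.empty) : b = fun _ => Ptn.empty := by
  induction N with
  | zero => exact Subsingleton.elim _ _
  | succ N ih =>
    have hb' := mul_ne_zero_iff.mp hb
    have hi := of_ind_ne_zero hb'.2
    have h2 : b (Fin.last N) = Ptn.empty := ht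
    rw [h2, interlace_empty_iff] at hi
    have := ih _ hb'.1 hi
    funext i
    refine Fin.lastCases h2 (fun j => congrFun this j) i

theorem chainInd_empty (N : ℕ) : chainInd (fun _ : Fin N => Ptn.empty) = 1 := by
  induction N with
  | zero => rfl
  | succ N ih =>
    have ht : top (fun _ : Fin N => Ptn.empty) = Ptn.empty := by cases N <;> rfl
    rw [chainInd, ih, ht, ind_true (interlace_empty_iff.mpr rfl), one_mul]

theorem tsum_growMatrix (x : ℝ≥0∞) (M N : ℕ) (F : (Fin N → Ptn) → ℝ≥0∞) :
    ∑' A : Fin M → Fin N → ℕ, (x * x) ^ (∑ i, ∑ j, A i j) * F (growMatrix A) =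
      ∑' b : Fin N → Ptn, chainInd b * x ^ (top b).size * (schur x M (top b) * F b) := by
  induction M generalizing F with
  | zero =>
    have ht : top (fun _ : Fin N => Ptn.empty) = Ptn.empty := by cases N <;> rfl
    rw [tsum_of_unique (β := Fin 0 → Fin N → ℕ),
      tsum_eq_single (fun _ : Fin N => Ptn.empty) (fun b hb => ?_)]
    · simp [growMatrix, chainInd_empty, ht, schur, ind_true]
    · by_cases h : chainInd b = 0
      · simp [h]
      · simp [schur, ind_false fun ht => hb (eq_empty_of_chainInd_ne_zero b h ht)]
  | succ M ih =>
    rw [tsum_snoc]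
    simp only [growMatrix, Fin.sum_univ_castSucc, Fin.snoc_castSucc, Fin.snoc_last]
    have h1 := ih fun a => ∑' w : Fin N → ℕ, (x * x) ^ (∑ j, w j) * F (growColumn a w)
    -- With `q = x * x`, `q^(|b| - |k|) x^|k| = x^|b| x^(|b| - |k|)`, where `|b|` is the size of
    -- `top b`: one factor stays with the chain, the other is the strip weight in the recursion for
    -- `schur x (M + 1)`.
    have h2 := tsum_growColumn (x * x) N fun k b => x ^ k.size * schur x M k * F b
    refine Eq.trans ?_ (h1.trans (Eq.trans ?_ (h2.trans ?_)))
    · refine tsum_congr fun A => ?_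
      rw [← ENNReal.tsum_mul_left]
      refine tsum_congr fun w => ?_
      rw [pow_add, mul_assoc]
    · refine tsum_congr fun a => ?_
      simp only [← ENNReal.tsum_mul_left]
      exact tsum_congr fun w => by ring
    · refine tsum_congr fun b => ?_
      rw [schur, ← ENNReal.tsum_mul_right, ← ENNReal.tsum_mul_left]
      refine tsum_congr fun k => ?_
      by_cases h : Interlace k (top b)
      · obtain ⟨d, hd⟩ := Nat.exists_eq_add_of_le h.size_le
        rw [hd, Nat.add_sub_cancel_left, pow_add, mul_pow]
        ring
      · simp [ind_false h]

/-- Cauchy's identity, refined by the first row of the shape. -/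
theorem tsum_growMatrix_top (x : ℝ≥0∞) (M N n : ℕ) :
    ∑' A : Fin M → Fin N → ℕ, (x * x) ^ (∑ i, ∑ j, A i j) *
        ind ((top (growMatrix A)).row 0 ≤ n) =
      ∑' l, schur x N l * (schur x M l * ind (l.row 0 ≤ n)) := by
  rw [tsum_growMatrix x M N fun b => ind ((top b).row 0 ≤ n),
    tsum_chain x N fun l => schur x M l * ind (l.row 0 ≤ n)]

end LastPassage

/-! ### First rows of the growth diagram and last passage times. -/

namespace LastPassage

/-- The last passage time of the array `a`, by its recursion. -/
def lpp (a : ℕ → ℕ → ℕ) : ℕ → ℕ → ℕ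
  | 0, _ => 0
  | _ + 1, 0 => 0
  | i + 1, j + 1 => max (lpp a i (j + 1)) (lpp a (i + 1) j) + a i j

theorem lpp_succ (a : ℕ → ℕ → ℕ) (i j : ℕ) :
    lpp a (i + 1) (j + 1) = max (lpp a i (j + 1)) (lpp a (i + 1) j) + a i j := by
  rw [lpp]

theorem lpp_zero_right (a : ℕ → ℕ → ℕ) (i : ℕ) : lpp a i 0 = 0 := by
  cases i <;> simp [lpp]

/-- On first rows the local rule is the last passage recursion, with `f` the previous column and `g`
the new one; index `0` is the empty boundary. -/
theorem growColumn_row_zero {N : ℕ} (α : Fin N → Ptn) (w : Fin N → ℕ) (f g v : ℕ → ℕ)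
    (hα : ∀ j : Fin N, (α j).row 0 = f (j + 1)) (hw : ∀ j : Fin N, w j = v j)
    (hg0 : g 0 = 0) (hg : ∀ j, g (j + 1) = max (f (j + 1)) (g j) + v j) (j : Fin N) :
    (growColumn α w j).row 0 = g (j + 1) := by
  induction N with
  | zero => exact j.elim0
  | succ N ih =>
    have h := ih (fun i : Fin N => α i.castSucc) (fun i => w i.castSucc)
      (fun j => hα j.castSucc) (fun j => hw j.castSucc)
    refine Fin.lastCases ?_ (fun j => ?_) j
    · have ht : (top (growColumn (fun i : Fin N => α i.castSucc) fun i => w i.castSucc)).row 0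
          = g N := by
        cases N with
        | zero => simp [top, hg0]
        | succ N => simpa [top] using h (Fin.last N)
      rw [growColumn, Fin.snoc_last, Ptn.grow_row_zero, ht, hα, hw, Fin.val_last, hg, max_comm]
    · rw [growColumn, Fin.snoc_castSucc]
      exact h j

theorem growMatrix_row_zero (a : ℕ → ℕ → ℕ) (M N : ℕ) (j : Fin N) :
    (growMatrix (fun (i : Fin M) (j : Fin N) => a i j) j).row 0 = lpp a M (j + 1) := by
  induction M generalizing j with
  | zero => simp [growMatrix, lpp]
  | succ M ih =>
    exact growColumn_row_zero _ _ (lpp a M) (lpp a (M + 1)) (a M) ih (fun _ => rfl)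
      (lpp_zero_right a _) (fun j => by rw [lpp]) j

theorem top_growMatrix_row_zero (a : ℕ → ℕ → ℕ) (M N : ℕ) :
    (top (growMatrix fun (i : Fin M) (j : Fin N) => a i j)).row 0 = lpp a M N := by
  cases N with
  | zero => simp [top, lpp_zero_right]
  | succ N => exact growMatrix_row_zero a M (N + 1) (Fin.last N)

section Paths

variable {s : ℕ → ℕ × ℕ} {L : ℕ}

theorem path_add_eq (h1 : s 1 = (1, 1))
    (hs : ∀ k, 1 ≤ k → k < L → s (k + 1) = s k + (1, 0) ∨ s (k + 1) = s k + (0, 1))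
    {k : ℕ} (hk : 1 ≤ k) (hkL : k ≤ L) :
    (s k).1 + (s k).2 = k + 1 ∧ 1 ≤ (s k).1 ∧ 1 ≤ (s k).2 := by
  induction k, hk using Nat.le_induction with
  | base => simp [h1]
  | succ k hk ih =>
    have := ih (by omega)
    rcases hs k hk (by omega) with h | h <;> rw [h] <;> simp <;> omega

theorem path_mono
    (hs : ∀ k, 1 ≤ k → k < L → s (k + 1) = s k + (1, 0) ∨ s (k + 1) = s k + (0, 1))
    {k l : ℕ} (hk : 1 ≤ k) (hkl : k ≤ l) (hl : l ≤ L) : s k ≤ s l := by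
  induction l, hkl using Nat.le_induction with
  | base => exact le_rfl
  | succ l hkl ih =>
    refine (ih (by omega)).trans ?_
    rcases hs l (by omega) (by omega) with h | h <;> rw [h] <;> simp

/-- The sum of coordinates determines the time. Hence a sum over the set of sites of a path is a sum
over its steps. -/
theorem path_injOn (h1 : s 1 = (1, 1))
    (hs : ∀ k, 1 ≤ k → k < L → s (k + 1) = s k + (1, 0) ∨ s (k + 1) = s k + (0, 1)) :
    Set.InjOn s (Finset.Icc 1 L) := by
  intro k hk l hl hkl
  simp only [Finset.coe_Icc, Set.mem_Icc] at hk hl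
  have h2 := (path_add_eq h1 hs hk.1 hk.2).1
  have h3 := (path_add_eq h1 hs hl.1 hl.2).1
  rw [hkl] at h2
  omega

theorem path_sum_le (w : ℕ × ℕ → ℕ) (h1 : s 1 = (1, 1))
    (hs : ∀ k, 1 ≤ k → k < L → s (k + 1) = s k + (1, 0) ∨ s (k + 1) = s k + (0, 1))
    {k : ℕ} (hk : 1 ≤ k) (hkL : k ≤ L) :
    ∑ l ∈ Finset.Icc 1 k, w (s l) ≤ lpp (fun i j => w (i + 1, j + 1)) (s k).1 (s k).2 := by
  induction k, hk using Nat.le_induction with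
  | base => simp [h1, lpp]
  | succ k hk ih =>
    have h2 := ih (by omega)
    have h3 := path_add_eq h1 hs hk (by omega)
    rw [Finset.sum_Icc_succ_top (by omega)]
    obtain ⟨i, j, hij⟩ : ∃ i j, s k = (i + 1, j + 1) :=
      ⟨(s k).1 - 1, (s k).2 - 1, Prod.ext (by simp; omega) (by simp; omega)⟩
    rw [hij] at h2
    rcases hs k hk (by omega) with h | h <;> rw [h, hij] <;>
      simp only [Prod.mk_add_mk, add_zero] <;> rw [lpp] <;> gcongr <;>
      refine h2.trans ?_ <;> simp

end Paths

theorem exists_path (w : ℕ × ℕ → ℕ) (i j : ℕ) : ∃ s : ℕ → ℕ × ℕ, s 1 = (1, 1) ∧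
    s (i + j + 1) = (i + 1, j + 1) ∧
    (∀ k, 1 ≤ k → k < i + j + 1 → s (k + 1) = s k + (1, 0) ∨ s (k + 1) = s k + (0, 1)) ∧
    ∑ k ∈ Finset.Icc 1 (i + j + 1), w (s k) =
      lpp (fun i j => w (i + 1, j + 1)) (i + 1) (j + 1) := by
  have extend : ∀ (L : ℕ) (p q : ℕ × ℕ), (q = p + (1, 0) ∨ q = p + (0, 1)) →
      (∃ s : ℕ → ℕ × ℕ, s 1 = (1, 1) ∧ s (L + 1) = p ∧
        (∀ k, 1 ≤ k → k < L + 1 → s (k + 1) = s k + (1, 0) ∨ s (k + 1) = s k + (0, 1)) ∧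
        ∑ k ∈ Finset.Icc 1 (L + 1), w (s k) = lpp (fun i j => w (i + 1, j + 1)) p.1 p.2) →
      ∃ s : ℕ → ℕ × ℕ, s 1 = (1, 1) ∧ s (L + 2) = q ∧
        (∀ k, 1 ≤ k → k < L + 2 → s (k + 1) = s k + (1, 0) ∨ s (k + 1) = s k + (0, 1)) ∧
        ∑ k ∈ Finset.Icc 1 (L + 2), w (s k) =
          lpp (fun i j => w (i + 1, j + 1)) p.1 p.2 + w q := by
    rintro L p q hpq ⟨s, h1, hL, hs, hsum⟩
    refine ⟨fun k => if k ≤ L + 1 then s k else q, by simp [h1], by simp, fun k hk hkL => ?_, ?_⟩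
    · by_cases hk' : k < L + 1
      · simpa [hk'.le, Nat.succ_le_iff.mpr hk', show k ≤ L by omega] using hs k hk hk'
      · obtain rfl : k = L + 1 := by omega
        simpa [hL] using hpq
    · rw [Finset.sum_Icc_succ_top (by omega), ← hsum]
      congr 1
      · refine Finset.sum_congr rfl fun k hk => ?_
        simp only [if_pos (Finset.mem_Icc.mp hk).2]
      · simp
  induction hn : i + j generalizing i j with
  | zero =>
    obtain ⟨rfl, rfl⟩ : i = 0 ∧ j = 0 := by omega
    refine ⟨fun _ => (1, 1), rfl, rfl, fun k h1 h2 => by omega, by simp [lpp]⟩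
  | succ n ih =>
    -- Backtracking through the recursion: the last step is `(1, 0)` if the left neighbour exists
    -- and either attains the maximum or is the only neighbour, and `(0, 1)` otherwise.
    by_cases hcase : 1 ≤ i ∧ (1 ≤ j → lpp (fun i j => w (i + 1, j + 1)) (i + 1) j ≤
        lpp (fun i j => w (i + 1, j + 1)) i (j + 1))
    · obtain ⟨i, rfl⟩ := Nat.exists_eq_add_of_le' hcase.1
      obtain ⟨s, h1, h2, h3, h4⟩ := extend n (i + 1, j + 1) (i + 1 + 1, j + 1) (by simp)
        (ih i j (by omega))
      refine ⟨s, h1, h2, h3, h4.trans ?_⟩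
      rw [lpp_succ _ (i + 1) j, max_eq_left]
      rcases j with _ | j
      · simp [lpp]
      · exact hcase.2 (by omega)
    · obtain ⟨j, rfl⟩ : ∃ j', j = j' + 1 := by
        refine Nat.exists_eq_add_of_le' ?_
        by_contra hj
        exact hcase ⟨by omega, fun h => absurd h hj⟩
      obtain ⟨s, h1, h2, h3, h4⟩ := extend n (i + 1, j + 1) (i + 1, j + 1 + 1) (by simp)
        (ih i j (by omega))
      refine ⟨s, h1, h2, h3, h4.trans ?_⟩
      rw [lpp_succ _ i (j + 1), max_eq_right]
      rcases i with _ | i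
      · simp [lpp]
      · by_contra hlt
        exact hcase ⟨by omega, fun _ => (not_le.mp hlt).le⟩

theorem G_eq_lpp (w : ℕ × ℕ → ℕ) (M N : ℕ) :
    G w M N = lpp (fun i j => w (i + 1, j + 1)) M N := by
  classical
  apply le_antisymm
  · refine Finset.sup_le fun π hπ => ?_
    obtain ⟨-, s, h1, hL, hs, rfl⟩ := Finset.mem_filter.mp hπ
    rw [Finset.sum_image (path_injOn h1 hs)]
    -- If the truncated length `M + N - 1` is zero, the path has no sites and weight zero.
    rcases Nat.eq_zero_or_pos (M + N - 1) with h | h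
    · simp [h]
    · have := path_sum_le w h1 hs h le_rfl
      rwa [hL] at this
  · rcases M with _ | i
    · simp [lpp]
    rcases N with _ | j
    · simp [lpp]
    obtain ⟨s, h1, hL, hs, hsum⟩ := exists_path w i j
    have hl : i + 1 + (j + 1) - 1 = i + j + 1 := by omega
    have hmem : (Finset.Icc 1 (i + j + 1)).image s ∈ upRightPaths (i + 1) (j + 1) := by
      refine Finset.mem_filter.mpr ⟨?_, s, h1, by rw [hl, hL], by rwa [hl], by rw [hl]⟩
      rw [Finset.mem_powerset, Finset.image_subset_iff]
      intro k hk
      rw [Finset.mem_Icc] at hk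
      have h2 := path_add_eq h1 hs hk.1 hk.2
      have h3 := path_mono hs hk.1 hk.2 le_rfl
      rw [hL] at h3
      simp only [Finset.mem_product, Finset.mem_Icc]
      exact ⟨⟨h2.2.1, h3.1⟩, h2.2.2, h3.2⟩
    refine le_trans (le_of_eq ?_) (Finset.le_sup (f := fun π => ∑ p ∈ π, w p) hmem)
    rw [Finset.sum_image (path_injOn h1 hs), hsum]

end LastPassage

/-! ### The law of the last passage time as a sum of products of Schur functions. -/

namespace LastPassage

open scoped ENNReal

section Environment

variable {Ω : Type*} [MeasurableSpace Ω] {μ : Measure Ω} {t : ℝ} {w : ℕ × ℕ → Ω → ℕ}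

/-- The site `(i + 1, j + 1)`. -/
def siteOf (M N : ℕ) (p : Fin M × Fin N) : Site := ⟨(p.1 + 1, p.2 + 1), by simp⟩

theorem siteOf_injective (M N : ℕ) : Function.Injective (siteOf M N) := by
  rintro ⟨a, b⟩ ⟨c, d⟩ h
  simp only [siteOf, Subtype.mk.injEq, Prod.mk.injEq, add_left_inj] at h
  exact Prod.ext (Fin.ext h.1) (Fin.ext h.2)

theorem IsGeometricEnvironment.measure_eq [IsProbabilityMeasure μ]
    (hw : IsGeometricEnvironment μ t w) (ht0 : 0 ≤ t) (ht1 : t ≤ 1) (M N : ℕ)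
    (A : Fin M → Fin N → ℕ) :
    μ {ω | (fun (i : Fin M) (j : Fin N) => w (i + 1, j + 1) ω) = A} =
      ENNReal.ofReal (1 - t ^ 2) ^ (M * N) *
        (ENNReal.ofReal t * ENNReal.ofReal t) ^ (∑ i, ∑ j, A i j) := by
  have hset : {ω | (fun (i : Fin M) (j : Fin N) => w (i + 1, j + 1) ω) = A} =
      ⋂ p ∈ (Finset.univ : Finset (Fin M × Fin N)), w (siteOf M N p) ⁻¹' {A p.1 p.2} := by
    ext ω
    simp [funext_iff, siteOf, Prod.forall]
  have ht : 0 ≤ 1 - t ^ 2 := by nlinarith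
  have hlaw : ∀ p : Fin M × Fin N, μ (w (siteOf M N p) ⁻¹' {A p.1 p.2}) =
      ENNReal.ofReal (1 - t ^ 2) * (ENNReal.ofReal t * ENNReal.ofReal t) ^ A p.1 p.2 := by
    intro p
    have h := hw.law (siteOf M N p) (A p.1 p.2)
    rw [← ENNReal.ofReal_mul ht0, ← ENNReal.ofReal_pow (by positivity), ← ENNReal.ofReal_mul ht,
      ← sq, ← h, ofReal_measureReal]
    rfl
  rw [hset, (hw.indep.precomp (siteOf_injective M N)).measure_inter_preimage_eq_mul Finset.univ
    (fun p _ => measurableSet_singleton _), Finset.prod_congr rfl fun p _ => hlaw p,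
    Finset.prod_mul_distrib, Finset.prod_pow_eq_pow_sum, Fintype.sum_prod_type]
  simp

/-- The environment has countably many values, so the probability is a sum over matrices. Each has
weight proportional to `(t * t)^(sum of entries)`, which is the weight in Cauchy's identity. -/
theorem IsGeometricEnvironment.measure_G_le [IsProbabilityMeasure μ]
    (hw : IsGeometricEnvironment μ t w) (ht0 : 0 ≤ t) (ht1 : t ≤ 1) (M N n : ℕ) :
    μ {ω | G (fun p => w p ω) M N ≤ n} = ENNReal.ofReal (1 - t ^ 2) ^ (M * N) *
      ∑' l, schur (ENNReal.ofReal t) N l * (schur (ENNReal.ofReal t) M l *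
        ind (l.row 0 ≤ n)) := by
  set X : Ω → Fin M → Fin N → ℕ := fun ω i j => w (i + 1, j + 1) ω with hX
  have hXm : Measurable X := measurable_pi_lambda _ fun i => measurable_pi_lambda _ fun j =>
    hw.measurable (siteOf M N (i, j))
  have hset : {ω | G (fun p => w p ω) M N ≤ n} =
      X ⁻¹' {A | (top (growMatrix A)).row 0 ≤ n} := by
    ext ω
    rw [Set.mem_ofPred_eq, G_eq_lpp, ← top_growMatrix_row_zero]
    rfl
  have hms : MeasurableSet {A : Fin M → Fin N → ℕ | (top (growMatrix A)).row 0 ≤ n} :=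
    (Set.to_countable _).measurableSet
  rw [hset, ← Measure.map_apply hXm hms, ← Measure.tsum_indicator_apply_singleton _ _ hms,
    ← tsum_growMatrix_top, ← ENNReal.tsum_mul_left]
  refine tsum_congr fun A => ?_
  by_cases h : (top (growMatrix A)).row 0 ≤ n
  · rw [Set.indicator_of_mem (by exact h), Measure.map_apply hXm (measurableSet_singleton _),
      ind_true h, mul_one]
    exact hw.measure_eq ht0 ht1 M N A
  · rw [Set.indicator_of_notMem (by exact h), ind_false h, mul_zero, mul_zero]

end Environment

end LastPassage

/-! ### Gessel's identity: Toeplitz determinants as sums over shapes. -/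

namespace LastPassage

open LaurentPolynomial

/-- Column heights of a partition with at most `n` columns. -/
def IsShape {n : ℕ} (a : Fin n → ℤ) : Prop := Antitone a ∧ ∀ i, 0 ≤ a i

/-- The indicator vector of a set of indices. -/
def indVec {n : ℕ} (s : Finset (Fin n)) : Fin n → ℤ := fun i => if i ∈ s then 1 else 0

theorem indVec_nonneg {n : ℕ} (s : Finset (Fin n)) (i : Fin n) : 0 ≤ indVec s i := by
  unfold indVec; split_ifs <;> simp

theorem indVec_le_one {n : ℕ} (s : Finset (Fin n)) (i : Fin n) : indVec s i ≤ 1 := by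
  unfold indVec; split_ifs <;> simp

open Classical in
/-- The weighted number of chains of vertical strips of length `K` from the empty shape to `a`. -/
def stripSum {R : Type*} [CommSemiring R] (x : R) (n : ℕ) : ℕ → (Fin n → ℤ) → R
  | 0, a => if a = 0 then 1 else 0
  | K + 1, a => if IsShape a then ∑ s : Finset (Fin n), x ^ s.card * stripSum x n K (a - indVec s)
      else 0

section Semiring

variable {R S : Type*} [CommSemiring R] [CommSemiring S]

/-- Determinants need the ring `ℂ`, while the sums over partitions take place in `ℝ≥0`; this
identifies the two versions of `stripSum`. -/
theorem map_stripSum (f : R →+* S) (x : R) (n K : ℕ) (a : Fin n → ℤ) :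
    f (stripSum x n K a) = stripSum (f x) n K a := by
  induction K generalizing a with
  | zero => simp only [stripSum]; split_ifs <;> simp
  | succ K ih => simp only [stripSum]; split_ifs <;> simp [ih]

theorem isShape_of_stripSum_ne_zero {x : R} {n K : ℕ} {a : Fin n → ℤ}
    (h : stripSum x n K a ≠ 0) : IsShape a := by
  cases K with
  | zero =>
    by_cases ha : a = 0
    · subst ha
      exact ⟨fun _ _ _ => le_rfl, fun _ => le_rfl⟩
    · simp [stripSum, ha] at h
  | succ K =>
    by_contra ha
    simp [stripSum, ha] at h

theorem le_of_stripSum_ne_zero {x : R} {n K : ℕ} {a : Fin n → ℤ}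
    (h : stripSum x n K a ≠ 0) (i : Fin n) : a i ≤ K := by
  induction K generalizing a with
  | zero =>
    by_cases ha : a = 0
    · simp [ha]
    · simp [stripSum, ha] at h
  | succ K ih =>
    have ha := isShape_of_stripSum_ne_zero h
    simp only [stripSum, ha, if_true] at h
    obtain ⟨s, -, hs⟩ := Finset.exists_ne_zero_of_sum_ne_zero h
    have h1 := ih (right_ne_zero_of_mul hs)
    have h2 := indVec_le_one s i
    simp only [Pi.sub_apply] at h1
    push_cast
    linarith

theorem stripSum_support_finite (x : R) (n K : ℕ) :
    (Function.support (stripSum x n K)).Finite := by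
  refine (Set.finite_Icc (0 : Fin n → ℤ) (fun _ => (K : ℤ))).subset fun a ha => ?_
  exact ⟨(isShape_of_stripSum_ne_zero ha).2, le_of_stripSum_ne_zero ha⟩

end Semiring

theorem antitone_of_adjacent {n : ℕ} {b : Fin n → ℤ}
    (h : ∀ i j : Fin n, (i : ℕ) + 1 = j → b j ≤ b i) : Antitone b := by
  cases n with
  | zero => exact fun i => i.elim0
  | succ n => exact Fin.antitone_iff_succ_le.mpr fun i => h _ _ (by simp)

variable {R : Type*} [CommRing R]

theorem coeff_mul_T (p : R[T;T⁻¹]) (d j : ℤ) : (p * T d).coeff j = p.coeff (j - d) := by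
  rw [T, AddMonoidAlgebra.coeff_mul_single_eq_coeff_mul (m₂ := j - d), mul_one]
  intro m _
  omega

theorem coeff_mul_one_add (p : R[T;T⁻¹]) (x : R) (d j : ℤ) :
    (p * (1 + C x * T d)).coeff j = p.coeff j + x * p.coeff (j - d) := by
  have : p * (1 + C x * T d) = p + x • (p * T d) := by
    rw [smul_eq_C_mul]; ring
  rw [this, AddMonoidAlgebra.coeff_add, AddMonoidAlgebra.coeff_smul, Finsupp.add_apply,
    Finsupp.smul_apply, coeff_mul_T, smul_eq_mul]

/-- The minor of the Toeplitz matrix of `p` with rows shifted by the shape `a`. -/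
def shiftDet (n : ℕ) (p : R[T;T⁻¹]) (a : Fin n → ℤ) : R :=
  (Matrix.of fun i j : Fin n => p.coeff (a i - (i : ℤ) + (j : ℤ))).det

/-- Each row becomes itself plus `x` times its shift by `d`; multilinearity gives one term for each
set `s` of shifted rows. -/
theorem shiftDet_mul_one_add (n : ℕ) (p : R[T;T⁻¹]) (x : R) (d : ℤ) (a : Fin n → ℤ) :
    shiftDet n (p * (1 + C x * T d)) a =
      ∑ s : Finset (Fin n), x ^ s.card * shiftDet n p (a - d • indVec s) := by
  have h := (Matrix.detRowAlternating (n := Fin n) (R := R)).toMultilinearMap.map_add_univ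
    (fun i j => x * p.coeff (a i - d - (i : ℤ) + (j : ℤ)))
    (fun i j => p.coeff (a i - (i : ℤ) + (j : ℤ)))
  refine Eq.trans (congrArg Matrix.det ?_) (h.trans (Finset.sum_congr rfl fun s _ => ?_))
  · ext i j
    simp only [Matrix.of_apply, coeff_mul_one_add, Pi.add_apply]
    rw [add_comm]
    congr 3
    ring
  · have h2 := (Matrix.detRowAlternating (n := Fin n) (R := R)).toMultilinearMap.map_smul_univ
      (fun i => if i ∈ s then x else 1)
      (fun i j => p.coeff ((a - d • indVec s) i - (i : ℤ) + (j : ℤ)))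
    rw [Finset.prod_ite_mem, Finset.univ_inter, Finset.prod_const, smul_eq_mul] at h2
    refine Eq.trans (congrArg _ ?_) h2
    ext i j
    by_cases hi : i ∈ s <;> simp [hi, indVec]

/-- Row `i` depends only on `b i - i`. An ascent between neighbours is by exactly one here, so it
makes two adjacent rows equal. -/
theorem shiftDet_eq_zero_of_not_antitone {n : ℕ} (p : R[T;T⁻¹]) {b : Fin n → ℤ}
    (hb : ∀ i j : Fin n, (i : ℕ) + 1 = j → b j ≤ b i + 1) (h : ¬Antitone b) :
    shiftDet n p b = 0 := by
  by_contra hne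
  refine h (antitone_of_adjacent fun i j hij => ?_)
  by_contra hlt
  have h1 := hb i j hij
  have hij' : i ≠ j := by rintro rfl; omega
  refine hne (Matrix.det_zero_of_row_eq hij' ?_)
  ext k
  simp only [Matrix.of_apply]
  congr 1
  omega

theorem shiftDet_sub_eq_zero {n : ℕ} (p : R[T;T⁻¹]) (hp : ∀ j < 0, p.coeff j = 0)
    {a : Fin n → ℤ} (ha : IsShape a) (s : Finset (Fin n)) (h : ¬IsShape (a - indVec s)) :
    shiftDet n p (a - indVec s) = 0 := by
  by_cases hanti : Antitone (a - indVec s)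
  · obtain ⟨i, hi⟩ : ∃ i, (a - indVec s) i < 0 := by
      by_contra! hc
      exact h ⟨hanti, hc⟩
    cases n with
    | zero => exact i.elim0
    | succ n =>
      -- If some value of a decreasing vector is negative, so is the last one, and the last row then
      -- contains only coefficients of negative degree.
      refine Matrix.det_eq_zero_of_row_eq_zero (Fin.last n) fun j => ?_
      have h1 := hanti (Fin.le_last i)
      have h2 := j.is_lt
      refine hp _ ?_
      rw [Fin.val_last]
      omega
  · refine shiftDet_eq_zero_of_not_antitone p (fun i j hij => ?_) hanti
    have h1 : a j ≤ a i := ha.1 (Fin.le_def.mpr (by omega))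
    have h2 := indVec_le_one s i
    have h3 := indVec_nonneg s j
    simp only [Pi.sub_apply]
    linarith

theorem shiftDet_add_eq_zero {n : ℕ} (p : R[T;T⁻¹])
    {a : Fin n → ℤ} (ha : ¬IsShape a) (s : Finset (Fin n)) (h : IsShape (a - indVec s)) :
    shiftDet n p a = 0 := by
  refine shiftDet_eq_zero_of_not_antitone p (fun i j hij => ?_) fun hanti => ha ⟨hanti, ?_⟩
  · have h1 : (a - indVec s) j ≤ (a - indVec s) i := h.1 (Fin.le_def.mpr (by omega))
    have h2 := indVec_le_one s j
    have h3 := indVec_nonneg s i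
    simp only [Pi.sub_apply] at h1
    linarith
  · intro i
    have h1 := h.2 i
    have h3 := indVec_nonneg s i
    simp only [Pi.sub_apply] at h1
    linarith

theorem coeff_one_add_pow_of_neg (x : R) (M : ℕ) {j : ℤ} (hj : j < 0) :
    (((1 + C x * T 1) ^ M : R[T;T⁻¹])).coeff j = 0 := by
  induction M generalizing j with
  | zero =>
    rw [pow_zero, ← T_zero, T_apply, if_neg (by omega)]
  | succ M ih => rw [pow_succ, coeff_mul_one_add, ih hj, ih (by omega), mul_zero, add_zero]

/-- The dual Jacobi–Trudi formula for equal variables: each factor removes a vertical strip, and the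
terms that are not shapes vanish on both sides. -/
theorem shiftDet_one_add_pow (x : R) (n M : ℕ) {a : Fin n → ℤ} (ha : IsShape a) :
    shiftDet n ((1 + C x * T 1) ^ M) a = stripSum x n M a := by
  induction M generalizing a with
  | zero =>
    rw [pow_zero, ← T_zero, stripSum]
    split_ifs with h
    · subst h
      rw [shiftDet, ← Matrix.det_one (n := Fin n)]
      congr 1
      ext i j
      simp only [Matrix.of_apply, T_apply, Matrix.one_apply, Pi.zero_apply]
      congr 1
      rw [eq_iff_iff, Fin.ext_iff]
      omega
    · obtain ⟨i, hi⟩ := Function.ne_iff.mp h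
      cases n with
      | zero => exact i.elim0
      | succ n =>
        -- A nonzero shape has `a 0 > 0`, so the first row contains only coefficients of `1` in
        -- positive degrees.
        refine Matrix.det_eq_zero_of_row_eq_zero 0 fun j => ?_
        have h1 := ha.1 (Fin.zero_le i)
        have h2 := ha.2 i
        simp only [Pi.zero_apply] at hi
        rw [Matrix.of_apply, T_apply, if_neg]
        rw [Fin.val_zero]
        omega
  | succ M ih =>
    rw [pow_succ, shiftDet_mul_one_add, stripSum, if_pos ha]
    refine Finset.sum_congr rfl fun s _ => ?_
    rw [one_smul]
    by_cases hs : IsShape (a - indVec s)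
    · rw [ih hs]
    · rw [shiftDet_sub_eq_zero _ (fun j hj => coeff_one_add_pow_of_neg x M hj) ha s hs]
      by_cases hz : stripSum x n M (a - indVec s) = 0
      · rw [hz]
      · exact absurd (isShape_of_stripSum_ne_zero hz) hs

/-- Factors `1 + x T⁻¹` shift rows the other way, so they add vertical strips to the empty shape.
The induction absorbs one factor into `p`, which is therefore arbitrary. -/
theorem shiftDet_zero_mul_pow (p : R[T;T⁻¹]) (x : R) (n K : ℕ) :
    shiftDet n (p * (1 + C x * T (-1)) ^ K) 0 = ∑ᶠ a, stripSum x n K a * shiftDet n p a := by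
  induction K generalizing p with
  | zero =>
    rw [pow_zero, mul_one, finsum_eq_single _ (0 : Fin n → ℤ)]
    · simp [stripSum]
    · intro a ha
      simp [stripSum, ha]
  | succ K ih =>
    have hfin : ∀ s : Finset (Fin n), (Function.support fun a => x ^ s.card *
        (stripSum x n K a * shiftDet n p (a + indVec s))).Finite := fun s =>
      (stripSum_support_finite x n K).subset fun a ha hz => ha (by simp [hz])
    rw [pow_succ', ← mul_assoc, ih]
    have h1 : ∀ a, stripSum x n K a * shiftDet n (p * (1 + C x * T (-1))) a =
        ∑ s : Finset (Fin n), x ^ s.card *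
          (stripSum x n K a * shiftDet n p (a + indVec s)) := fun a => by
      rw [shiftDet_mul_one_add, Finset.mul_sum]
      refine Finset.sum_congr rfl fun s _ => ?_
      rw [neg_smul, one_smul, sub_neg_eq_add]
      ring
    rw [finsum_congr h1, finsum_sum_comm _ _ fun s _ => hfin s]
    -- The sum is reindexed by the enlarged shape, to match the recursion of `stripSum`; enlarged
    -- vectors that are not shapes give zero minors.
    have h2 : ∀ s : Finset (Fin n), ∑ᶠ a, x ^ s.card *
          (stripSum x n K a * shiftDet n p (a + indVec s)) =
        ∑ᶠ a, x ^ s.card * (stripSum x n K (a - indVec s) * shiftDet n p a) := fun s => by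
      rw [← finsum_comp_equiv (Equiv.subRight (indVec s))]
      simp
    have hfin2 : ∀ s : Finset (Fin n), (Function.support fun a => x ^ s.card *
        (stripSum x n K (a - indVec s) * shiftDet n p a)).Finite := fun s => by
      refine ((stripSum_support_finite x n K).preimage
        (f := fun a => a - indVec s) (sub_left_injective.injOn)).subset fun a ha hz => ha ?_
      simp [hz]
    rw [Finset.sum_congr rfl fun s _ => h2 s, ← finsum_sum_comm _ _ fun s _ => hfin2 s]
    refine finsum_congr fun a => ?_
    rw [stripSum]
    split_ifs with ha
    · rw [Finset.sum_mul]
      exact Finset.sum_congr rfl fun s _ => by ring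
    · rw [zero_mul]
      refine Finset.sum_eq_zero fun s _ => ?_
      by_cases hs : stripSum x n K (a - indVec s) = 0
      · rw [hs, zero_mul, mul_zero]
      · rw [shiftDet_add_eq_zero p ha s (isShape_of_stripSum_ne_zero hs), mul_zero, mul_zero]

theorem det_toeplitz_eq_finsum (x : R) (M N n : ℕ) :
    (Matrix.of fun j k : Fin n =>
      ((1 + C x * T 1) ^ M * (1 + C x * T (-1)) ^ N : R[T;T⁻¹]).coeff ((j : ℤ) - (k : ℤ))).det =
      ∑ᶠ a : Fin n → ℤ, stripSum x n N a * stripSum x n M a := by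
  rw [← Matrix.det_transpose]
  have h := shiftDet_zero_mul_pow ((1 + C x * T 1) ^ M) x n N
  have h0 : ∀ i j : Fin n, ((0 : Fin n → ℤ) i - (i : ℤ) + (j : ℤ)) = (j : ℤ) - (i : ℤ) := by
    intro i j
    rw [Pi.zero_apply]
    ring
  simp only [shiftDet, h0] at h
  refine h.trans (finsum_congr fun a => ?_)
  by_cases ha : stripSum x n N a = 0
  · simp [ha]
  · rw [← shiftDet_one_add_pow x n M (isShape_of_stripSum_ne_zero ha), shiftDet]

end LastPassage

/-! ### Conjugation of partitions: Schur functions in terms of column heights. -/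

namespace LastPassage

open scoped ENNReal NNReal

namespace Ptn

theorem exists_row_le (l : Ptn) (j : ℕ) : ∃ i, l.row i ≤ j :=
  l.vanish.imp fun _ h => h.le.trans (Nat.zero_le j)

theorem lt_find_iff (l : Ptn) (i j : ℕ) : i < Nat.find (l.exists_row_le j) ↔ j < l.row i := by
  rw [Nat.lt_find_iff]
  refine ⟨fun h => not_le.mp (h i le_rfl), fun h k hk => not_le.mpr (h.trans_le (l.anti hk))⟩

/-- The conjugate partition. -/
def conj (l : Ptn) : Ptn where
  row j := Nat.find (l.exists_row_le j)
  anti j j' hj := by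
    refine le_of_forall_lt fun i hi => ?_
    rw [lt_find_iff] at hi ⊢
    omega
  vanish := by
    refine ⟨l.row 0, Nat.eq_zero_of_not_pos ?_⟩
    rw [lt_find_iff]
    exact lt_irrefl _

/-- Both sides say that the box `(i, j)` lies in the diagram; the properties of `conj` below rest on
this symmetry. -/
theorem lt_conj_row (l : Ptn) (i j : ℕ) : i < l.conj.row j ↔ j < l.row i := l.lt_find_iff i j

theorem conj_conj (l : Ptn) : l.conj.conj = l := by
  ext i
  refine eq_of_forall_lt_iff fun j => ?_
  rw [lt_conj_row, lt_conj_row]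

theorem conj_row_eq_zero (l : Ptn) {n j : ℕ} (hl : l.row 0 ≤ n) (hj : n ≤ j) :
    l.conj.row j = 0 := by
  refine Nat.eq_zero_of_not_pos ?_
  rw [lt_conj_row]
  omega

theorem size_conj (l : Ptn) : l.conj.size = l.size := by
  obtain ⟨R, hR⟩ := l.vanish
  have h0 : l.conj.row (l.row 0) = 0 := l.conj_row_eq_zero le_rfl le_rfl
  have count : ∀ {m B : ℕ}, m ≤ B → m = ∑ j ∈ Finset.range B, if j < m then 1 else 0 := by
    intro m B hm
    rw [Finset.sum_boole, ← Finset.card_range m]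
    simp only [Nat.cast_id]
    congr 1
    ext j
    simp
    omega
  rw [size_eq _ hR, size_eq _ h0]
  have h1 : ∀ j ∈ Finset.range (l.row 0), l.conj.row j =
      ∑ i ∈ Finset.range R, if i < l.conj.row j then 1 else 0 := fun j _ => by
    refine count (not_lt.mp ?_)
    rw [lt_conj_row, hR]
    omega
  have h2 : ∀ i ∈ Finset.range R, l.row i =
      ∑ j ∈ Finset.range (l.row 0), if j < l.row i then 1 else 0 := fun i _ =>
    count (l.anti (Nat.zero_le i))
  rw [Finset.sum_congr rfl h1, Finset.sum_congr rfl h2, Finset.sum_comm]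
  simp only [lt_conj_row]

/-- A horizontal strip has at most one box in each column, so in column heights a strip is an added
indicator vector. -/
theorem interlace_iff_conj {k l : Ptn} :
    Interlace k l ↔ ∀ j, k.conj.row j ≤ l.conj.row j ∧ l.conj.row j ≤ k.conj.row j + 1 := by
  constructor
  · intro h j
    constructor
    · refine le_of_forall_lt fun i hi => ?_
      rw [lt_conj_row] at hi ⊢
      exact hi.trans_le (h i).2
    · refine le_of_forall_lt fun i hi => ?_
      rcases i with _ | i
      · omega
      · rw [lt_conj_row] at hi
        have := (k.lt_conj_row i j).mpr (hi.trans_le (h i).1)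
        omega
  · intro h i
    constructor
    · refine le_of_forall_lt fun j hj => ?_
      rw [← lt_conj_row] at hj ⊢
      have := (h j).2
      omega
    · refine le_of_forall_lt fun j hj => ?_
      rw [← lt_conj_row] at hj ⊢
      exact hj.trans_le (h j).1

/-- The heights of the first `n` columns. -/
def cols (n : ℕ) (l : Ptn) : Fin n → ℤ := fun j => l.conj.row j

theorem isShape_cols (n : ℕ) (l : Ptn) : IsShape (cols n l) :=
  ⟨fun _ _ h => Int.ofNat_le.mpr (l.conj.anti h), fun _ => Int.natCast_nonneg _⟩

theorem cols_injOn (n : ℕ) : Set.InjOn (cols n) {l | l.row 0 ≤ n} := by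
  intro k hk l hl h
  rw [← conj_conj k, ← conj_conj l]
  congr 1
  ext j
  by_cases hj : j < n
  · exact Int.ofNat_inj.mp (congrFun h ⟨j, hj⟩)
  · rw [conj_row_eq_zero k hk (not_lt.mp hj), conj_row_eq_zero l hl (not_lt.mp hj)]

theorem exists_cols_eq {n : ℕ} {a : Fin n → ℤ} (ha : IsShape a) :
    ∃ l : Ptn, l.row 0 ≤ n ∧ cols n l = a := by
  let b : Ptn :=
    { row := fun j => if h : j < n then (a ⟨j, h⟩).toNat else 0
      anti := by
        intro i j hij
        by_cases hj : j < n
        · have hi : i < n := hij.trans_lt hj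
          simp only [hi, hj, dif_pos]
          exact Int.toNat_le_toNat (ha.1 hij)
        · simp [hj]
      vanish := ⟨n, by simp⟩ }
  refine ⟨b.conj, not_lt.mp ?_, ?_⟩
  · rw [lt_conj_row]
    simp [b]
  · funext j
    rw [cols, conj_conj]
    simp [b, ha.2 j]

theorem size_eq_sum_cols {n : ℕ} {l : Ptn} (hl : l.row 0 ≤ n) :
    (l.size : ℤ) = ∑ j, cols n l j := by
  rw [← size_conj, size_eq _ (l.conj_row_eq_zero hl le_rfl), Finset.sum_range]
  simp [cols]

/-- The columns in which `l` exceeds `k`. -/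
def colDiff (n : ℕ) (k l : Ptn) : Finset (Fin n) :=
  Finset.univ.filter fun j => cols n k j < cols n l j

theorem Interlace.cols_eq {k l : Ptn} (h : Interlace k l) (n : ℕ) :
    cols n k = cols n l - indVec (colDiff n k l) := by
  funext j
  have h1 := interlace_iff_conj.mp h j
  simp only [cols, indVec, colDiff, Pi.sub_apply, Finset.mem_filter, Finset.mem_univ, true_and,
    Nat.cast_lt]
  split_ifs <;> omega

theorem interlace_of_cols_eq {n : ℕ} {k l : Ptn} {s : Finset (Fin n)} (hk : k.row 0 ≤ n)
    (hl : l.row 0 ≤ n) (h : cols n k = cols n l - indVec s) : Interlace k l := by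
  rw [interlace_iff_conj]
  intro j
  by_cases hj : j < n
  · have h1 := congrFun h ⟨j, hj⟩
    have h2 := indVec_nonneg s ⟨j, hj⟩
    have h3 := indVec_le_one s ⟨j, hj⟩
    simp only [cols, Pi.sub_apply] at h1
    omega
  · rw [conj_row_eq_zero k hk (not_lt.mp hj), conj_row_eq_zero l hl (not_lt.mp hj)]
    omega

theorem indVec_injective {n : ℕ} : Function.Injective (indVec (n := n)) := by
  intro s s' h
  ext i
  have := congrFun h i
  simp only [indVec] at this
  split_ifs at this <;> simp_all

theorem sum_indVec {n : ℕ} (s : Finset (Fin n)) : ∑ i, indVec s i = s.card := by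
  simp [indVec]

end Ptn

open Ptn

/-- The two recursions agree: a strip `l / k` corresponds to the set of columns it meets, whose
cardinality is `|l| - |k|`. The bound on the first row passes from `l` to `k`. -/
theorem schur_eq_stripSum (x : ℝ≥0) (n N : ℕ) {l : Ptn} (hl : l.row 0 ≤ n) :
    schur x N l = (stripSum x n N (cols n l) : ℝ≥0) := by
  induction N generalizing l with
  | zero =>
    have h0 : cols n Ptn.empty = 0 := by
      have h := (isShape_cols n Ptn.empty).2
      have h1 := size_eq_sum_cols (n := n) (l := Ptn.empty) (by simp)
      rw [size_empty, Nat.cast_zero] at h1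
      have := (Finset.sum_eq_zero_iff_of_nonneg fun i _ => h i).mp h1.symm
      exact funext fun i => this i (Finset.mem_univ i)
    rw [schur, stripSum]
    by_cases h : l = Ptn.empty
    · rw [ind_true h, if_pos (h ▸ h0), ENNReal.coe_one]
    · rw [ind_false h, if_neg, ENNReal.coe_zero]
      rw [← h0]
      exact fun hc => h (cols_injOn n hl (by simp) hc)
  | succ N ih =>
    rw [schur, stripSum, if_pos (isShape_cols n l), ENNReal.ofNNReal_finsetSum, ← tsum_fintype (L := .unconditional _)]
    symm
    have hI : ∀ k : Function.support (fun k => ind (Interlace k l) * (x : ℝ≥0∞) ^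
        (l.size - k.size) * schur x N k), Interlace k.1 l := by
      rintro ⟨k, hk⟩
      exact of_ind_ne_zero (left_ne_zero_of_mul (left_ne_zero_of_mul hk))
    have hI0 : ∀ {k}, Interlace k l → k.row 0 ≤ n := fun h => ((h 0).2).trans hl
    have hval : ∀ k, Interlace k l →
        ((x ^ (colDiff n k l).card * stripSum x n N (cols n l - indVec (colDiff n k l)) : ℝ≥0) :
          ℝ≥0∞) = ind (Interlace k l) * (x : ℝ≥0∞) ^ (l.size - k.size) * schur x N k := by
      intro k hk
      have h1 := size_eq_sum_cols hl
      have h2 := size_eq_sum_cols (hI0 hk)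
      rw [hk.cols_eq n] at h2
      simp only [Pi.sub_apply, Finset.sum_sub_distrib, sum_indVec] at h2
      have h3 : (colDiff n k l).card = l.size - k.size := by omega
      rw [ind_true hk, ih (hI0 hk), one_mul, hk.cols_eq n, ← h3]
      push_cast
      rfl
    refine tsum_eq_tsum_of_ne_zero_bij (fun k => colDiff n k.1 l) ?_ ?_ ?_
    · intro k k' h
      refine Subtype.ext (cols_injOn n (hI0 (hI k)) (hI0 (hI k')) ?_)
      simp only at h
      rw [(hI k).cols_eq n, (hI k').cols_eq n, h]
    · intro s hs
      have hs' : stripSum x n N (cols n l - indVec s) ≠ 0 := by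
        intro hz
        exact hs (by simp [hz])
      obtain ⟨k, hk, hks⟩ := exists_cols_eq (isShape_of_stripSum_ne_zero hs')
      have hkl := interlace_of_cols_eq hk hl hks
      have hd : colDiff n k l = s := by
        refine indVec_injective ?_
        have := hkl.cols_eq n
        rw [hks] at this
        exact (sub_right_injective this).symm
      refine ⟨⟨k, ?_⟩, hd⟩
      rw [Function.mem_support, ← hval k hkl, hd]
      exact hs
    · exact fun k => hval k.1 (hI k)

/-- The sum of `s_l(x, …, x) s_l(x, …, x)`, in `N` and `M` variables, over the partitions `l`
with at most `n` columns. -/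
def cauchySum (x : ℝ≥0) (M N n : ℕ) : ℝ≥0 :=
  ∑ᶠ a : Fin n → ℤ, stripSum x n N a * stripSum x n M a

theorem tsum_schur_mul_schur (x : ℝ≥0) (M N n : ℕ) :
    ∑' l, schur x N l * (schur x M l * ind (l.row 0 ≤ n)) = cauchySum x M N n := by
  have hfin : (Function.support fun a : Fin n → ℤ => stripSum x n N a * stripSum x n M a).Finite :=
    (stripSum_support_finite x n N).subset fun a ha => left_ne_zero_of_mul ha
  rw [cauchySum, finsum_eq_sum _ hfin, ENNReal.ofNNReal_finsetSum,
    ← tsum_eq_sum (L := .unconditional _) (s := hfin.toFinset)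
      (f := fun a => ((stripSum x n N a * stripSum x n M a : ℝ≥0) : ℝ≥0∞))]
  · symm
    have hI : ∀ l : Function.support (fun l => schur x N l * (schur x M l * ind (l.row 0 ≤ n))),
        l.1.row 0 ≤ n := by
      rintro ⟨l, hl⟩
      exact of_ind_ne_zero (right_ne_zero_of_mul (right_ne_zero_of_mul hl))
    have hval : ∀ l : Ptn, l.row 0 ≤ n →
        ((stripSum x n N (cols n l) * stripSum x n M (cols n l) : ℝ≥0) : ℝ≥0∞) =
          schur x N l * (schur x M l * ind (l.row 0 ≤ n)) := fun l hl => by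
      rw [ind_true hl, schur_eq_stripSum x n N hl, schur_eq_stripSum x n M hl]
      push_cast
      ring
    refine tsum_eq_tsum_of_ne_zero_bij (fun l => cols n l.1) ?_ ?_ fun l => hval l.1 (hI l)
    · exact fun k l h => Subtype.ext (cols_injOn n (hI k) (hI l) h)
    · intro a ha
      have ha' : stripSum x n N a ≠ 0 := fun hz => ha (by simp [hz])
      obtain ⟨l, hl, rfl⟩ := exists_cols_eq (isShape_of_stripSum_ne_zero ha')
      refine ⟨⟨l, ?_⟩, rfl⟩
      rw [Function.mem_support, ← hval l hl]
      exact ha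
  · intro a ha
    rw [Set.Finite.mem_toFinset, Function.notMem_support] at ha
    rw [ha, ENNReal.coe_zero]

/-- The empty partition contributes at least `1`. This is the source of `D_n ≠ 0`. -/
theorem one_le_cauchySum (x : ℝ≥0) (M N n : ℕ) : 1 ≤ cauchySum x M N n := by
  have h0 : ∀ K, 1 ≤ stripSum x n K 0 := by
    intro K
    induction K with
    | zero => simp [stripSum]
    | succ K ih =>
      rw [stripSum, if_pos ⟨fun _ _ _ => le_rfl, fun _ => le_rfl⟩]
      refine le_trans ?_ (Finset.single_le_sum (fun _ _ => zero_le) (Finset.mem_univ ∅))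
      have : indVec (∅ : Finset (Fin n)) = 0 := by funext i; simp [indVec]
      simpa [this] using ih
  have hfin : (Function.support fun a : Fin n → ℤ => stripSum x n N a * stripSum x n M a).Finite :=
    (stripSum_support_finite x n N).subset fun a ha => left_ne_zero_of_mul ha
  calc (1 : ℝ≥0) ≤ stripSum x n N 0 * stripSum x n M 0 := one_le_mul (h0 N) (h0 M)
    _ ≤ _ := single_le_finsum 0 hfin fun _ => zero_le

end LastPassage

/-! ### Laurent polynomials on the circle and their Cauchy transforms. -/

namespace CircleRHP

open LaurentPolynomial
open scoped Topology

/-- The value of a Laurent polynomial. -/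
def ev (p : ℂ[T;T⁻¹]) (z : ℂ) : ℂ := p.coeff.sum fun m a => a * z ^ m

theorem ev_add (p q : ℂ[T;T⁻¹]) (z : ℂ) : ev (p + q) z = ev p z + ev q z := by
  rw [ev, AddMonoidAlgebra.coeff_add]
  exact Finsupp.sum_add_index' (fun _ => zero_mul _) fun _ _ _ => add_mul _ _ _

theorem ev_eq_eval₂ (p : ℂ[T;T⁻¹]) {z : ℂ} (hz : z ≠ 0) :
    ev p z = eval₂ (RingHom.id ℂ) (Units.mk0 z hz) p := by
  induction p using LaurentPolynomial.induction_on' with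
  | add p q hp hq => rw [ev_add, map_add, hp, hq]
  | C_mul_T n a =>
    rw [← single_eq_C_mul_T, ev, AddMonoidAlgebra.coeff_single, Finsupp.sum_single_index (by simp),
      single_eq_C_mul_T, eval₂_C_mul_T]
    simp

theorem ev_C_mul_T (a : ℂ) (n : ℤ) (z : ℂ) : ev (C a * T n) z = a * z ^ n := by
  rw [← single_eq_C_mul_T, ev, AddMonoidAlgebra.coeff_single, Finsupp.sum_single_index (by simp)]

theorem ev_C (a z : ℂ) : ev (C a) z = a := by
  simpa using ev_C_mul_T a 0 z

theorem ev_one (z : ℂ) : ev 1 z = 1 := by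
  simpa using ev_C 1 z

theorem ev_zero (z : ℂ) : ev 0 z = 0 := by simp [ev]

theorem ev_T (n : ℤ) (z : ℂ) : ev (T n) z = z ^ n := by
  simpa using ev_C_mul_T 1 n z

/-- At `z = 0` this fails for `T 1 * T (-1) = 1`, because `0 ^ m = 0` for every `m ≠ 0`. -/
theorem ev_mul (p q : ℂ[T;T⁻¹]) {z : ℂ} (hz : z ≠ 0) : ev (p * q) z = ev p z * ev q z := by
  simp only [ev_eq_eval₂ _ hz, map_mul]

theorem ev_pow (p : ℂ[T;T⁻¹]) (n : ℕ) {z : ℂ} (hz : z ≠ 0) : ev (p ^ n) z = ev p z ^ n := by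
  simp only [ev_eq_eval₂ _ hz, map_pow]

theorem ev_C_mul (a : ℂ) (p : ℂ[T;T⁻¹]) (z : ℂ) : ev (C a * p) z = a * ev p z := by
  rw [← smul_eq_C_mul, ev, ev, AddMonoidAlgebra.coeff_smul, Finsupp.sum_smul_index (by simp),
    Finsupp.mul_sum]
  simp only [mul_assoc]

theorem ev_neg (p : ℂ[T;T⁻¹]) (z : ℂ) : ev (-p) z = -ev p z := by
  have h := ev_C_mul (-1) p z
  rwa [map_neg, map_one, neg_one_mul, neg_one_mul] at h

theorem ev_sum {ι : Type*} (s : Finset ι) (f : ι → ℂ[T;T⁻¹]) (z : ℂ) :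
    ev (∑ i ∈ s, f i) z = ∑ i ∈ s, ev (f i) z := by
  classical
  induction s using Finset.induction_on with
  | empty => simp [ev]
  | insert i s hi ih => rw [Finset.sum_insert hi, Finset.sum_insert hi, ev_add, ih]

theorem differentiableAt_ev (p : ℂ[T;T⁻¹]) {z : ℂ} (hz : z ≠ 0) :
    DifferentiableAt ℂ (ev p) z := by
  refine DifferentiableAt.fun_sum fun m _ => ?_
  exact (differentiableAt_zpow.mpr (Or.inl hz)).const_mul _

theorem differentiable_ev (p : ℂ[T;T⁻¹]) (hp : ∀ m < 0, p.coeff m = 0) :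
    Differentiable ℂ (ev p) := by
  intro z
  refine DifferentiableAt.fun_sum fun m hm => ?_
  refine (differentiableAt_zpow.mpr (Or.inr ?_)).const_mul _
  by_contra hlt
  exact Finsupp.mem_support_iff.mp hm (hp m (not_le.mp hlt))

/-- The terms of nonnegative degree. -/
def posPart (p : ℂ[T;T⁻¹]) : ℂ[T;T⁻¹] := .ofCoeff (p.coeff.filter (0 ≤ ·))

/-- The terms of negative degree. -/
def negPart (p : ℂ[T;T⁻¹]) : ℂ[T;T⁻¹] := .ofCoeff (p.coeff.filter fun m => ¬0 ≤ m)

theorem posPart_add_negPart (p : ℂ[T;T⁻¹]) : posPart p + negPart p = p := by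
  refine AddMonoidAlgebra.ext ?_
  rw [AddMonoidAlgebra.coeff_add]
  exact Finsupp.filter_add_filter_not _ _

theorem coeff_posPart (p : ℂ[T;T⁻¹]) (m : ℤ) :
    (posPart p).coeff m = if 0 ≤ m then p.coeff m else 0 := by
  simp [posPart, Finsupp.filter_apply]

theorem coeff_negPart (p : ℂ[T;T⁻¹]) (m : ℤ) :
    (negPart p).coeff m = if 0 ≤ m then 0 else p.coeff m := by
  simp only [negPart, Finsupp.filter_apply, AddMonoidAlgebra.coeff_ofCoeff]
  split_ifs <;> simp_all

theorem ev_posPart (p : ℂ[T;T⁻¹]) (z : ℂ) :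
    ev (posPart p) z = p.coeff.sum fun m a => a * if 0 ≤ m then z ^ m else 0 := by
  rw [ev, posPart, AddMonoidAlgebra.coeff_ofCoeff, Finsupp.sum_filter_index, Finsupp.sum,
    Finsupp.support_filter, Finset.sum_filter]
  refine Finset.sum_congr rfl fun m _ => ?_
  split_ifs <;> simp

theorem ev_negPart (p : ℂ[T;T⁻¹]) (z : ℂ) :
    -ev (negPart p) z = p.coeff.sum fun m a => a * if 0 ≤ m then 0 else -z ^ m := by
  rw [ev, negPart, AddMonoidAlgebra.coeff_ofCoeff, Finsupp.sum_filter_index, Finsupp.sum,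
    Finsupp.support_filter, Finset.sum_filter, ← Finset.sum_neg_distrib]
  refine Finset.sum_congr rfl fun m _ => ?_
  split_ifs <;> simp

theorem circleIntegral_zpow (m : ℤ) :
    (2 * (Real.pi : ℂ) * Complex.I)⁻¹ * ∮ z in C(0, 1), z ^ m = if m = -1 then 1 else 0 := by
  split_ifs with h
  · subst h
    have := circleIntegral.integral_sub_center_inv (0 : ℂ) (one_ne_zero (α := ℝ))
    simp only [sub_zero] at this
    simp only [zpow_neg_one, this]
    exact inv_mul_cancel₀ Complex.two_pi_I_ne_zero
  · have := circleIntegral.integral_sub_zpow_of_ne h (0 : ℂ) 0 1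
    simp only [sub_zero] at this
    rw [this, mul_zero]

theorem ne_zero_of_mem_sphere {z : ℂ} (hz : z ∈ Metric.sphere (0 : ℂ) 1) : z ≠ 0 := by
  rintro rfl
  simp at hz

theorem circleMean_congr {f g : ℂ → ℂ} (h : ∀ z, ‖z‖ = 1 → f z = g z) :
    circleMean f = circleMean g := by
  rw [circleMean, circleMean]
  congr 1
  refine circleIntegral.integral_congr zero_le_one fun z hz => ?_
  simp only [h z (by simpa using hz)]

theorem circleIntegrable_zpow_mul {g : ℂ → ℂ} (hg : ContinuousOn g (Metric.sphere 0 1)) (m : ℤ) :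
    CircleIntegrable (fun z => z ^ m * g z) 0 1 := by
  refine ContinuousOn.circleIntegrable zero_le_one (ContinuousOn.mul (fun z hz => ?_) hg)
  exact (continuousAt_zpow₀ z m (Or.inl (ne_zero_of_mem_sphere hz))).continuousWithinAt

theorem circleIntegral_ev_mul {g : ℂ → ℂ} (hg : ContinuousOn g (Metric.sphere 0 1))
    (p : ℂ[T;T⁻¹]) : (∮ z in C(0, 1), ev p z * g z) =
      p.coeff.sum fun m a => a * ∮ z in C(0, 1), z ^ m * g z := by
  simp only [ev, Finsupp.sum, Finset.sum_mul]
  rw [circleIntegral.integral_fun_sum]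
  · refine Finset.sum_congr rfl fun m _ => ?_
    simp only [mul_assoc]
    rw [circleIntegral.integral_const_mul]
  · intro m _
    simp only [mul_assoc]
    have := (circleIntegrable_zpow_mul hg m).const_smul (a := p.coeff m)
    simpa [Pi.smul_def] using this

theorem circleMean_ev (p : ℂ[T;T⁻¹]) : circleMean (ev p) = p.coeff 0 := by
  have hg : ContinuousOn (fun z : ℂ => z⁻¹) (Metric.sphere 0 1) := fun z hz =>
    (continuousAt_inv₀ (ne_zero_of_mem_sphere hz)).continuousWithinAt
  have h : ∀ m : ℤ, (2 * (Real.pi : ℂ) * Complex.I)⁻¹ * (∮ z in C(0, 1), z ^ m * z⁻¹) =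
      if m = 0 then 1 else 0 := by
    intro m
    have h2 := circleIntegral_zpow (m - 1)
    have h3 : (m - 1 = -1) ↔ m = 0 := by omega
    simp only [h3] at h2
    rw [← h2]
    congr 1
    refine circleIntegral.integral_congr zero_le_one fun z hz => ?_
    simp only [zpow_sub_one₀ (ne_zero_of_mem_sphere hz)]
  simp only [circleMean, div_eq_mul_inv]
  rw [circleIntegral_ev_mul hg, Finsupp.mul_sum, Finsupp.sum]
  simp only [mul_left_comm _ (p.coeff _), h]
  simp only [mul_ite, mul_one, mul_zero]
  rw [Finset.sum_ite_eq']
  simp +contextual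

theorem sub_ne_zero_of_mem_sphere {s z : ℂ} (hs : s ∈ Metric.sphere (0 : ℂ) 1) (hz : ‖z‖ ≠ 1) :
    s - z ≠ 0 := by
  intro h
  rw [sub_eq_zero] at h
  subst h
  simp [hz] at hs

theorem continuousOn_inv_sub {z : ℂ} (hz : ‖z‖ ≠ 1) :
    ContinuousOn (fun s : ℂ => (s - z)⁻¹) (Metric.sphere 0 1) :=
  ContinuousOn.inv₀ (by fun_prop) fun _ hs => sub_ne_zero_of_mem_sphere hs hz

theorem cauchyTransform_congr {f g : ℂ → ℂ} (h : ∀ z, ‖z‖ = 1 → f z = g z) (z : ℂ) :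
    cauchyTransform f z = cauchyTransform g z := by
  rw [cauchyTransform, cauchyTransform]
  congr 1
  refine circleIntegral.integral_congr zero_le_one fun s hs => ?_
  simp only [h s (by simpa using hs)]

/-- From `s^(m+1) / (s - z) = s^m + z s^m / (s - z)`. Together with the case `m = 0` it yields all
powers, upwards and downwards. -/
theorem cauchyTransform_zpow_succ {z : ℂ} (hz : ‖z‖ ≠ 1) (m : ℤ) :
    cauchyTransform (fun s => s ^ (m + 1)) z =
      (if m = -1 then 1 else 0) + z * cauchyTransform (fun s => s ^ m) z := by
  have hg := continuousOn_inv_sub hz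
  rw [← circleIntegral_zpow, cauchyTransform, cauchyTransform, mul_left_comm z, ← mul_add]
  congr 1
  rw [← circleIntegral.integral_const_mul, ← circleIntegral.integral_add]
  · refine circleIntegral.integral_congr zero_le_one fun s hs => ?_
    have h1 := sub_ne_zero_of_mem_sphere hs hz
    simp only [zpow_add_one₀ (ne_zero_of_mem_sphere hs)]
    field_simp
    ring
  · simpa using circleIntegrable_zpow_mul (g := fun _ => 1) continuousOn_const m
  · have := (circleIntegrable_zpow_mul hg m).const_smul (a := z)
    simpa [Pi.smul_def, div_eq_mul_inv] using this

theorem cauchyTransform_zpow_inside {z : ℂ} (hz : ‖z‖ < 1) (m : ℤ) :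
    cauchyTransform (fun s => s ^ m) z = if 0 ≤ m then z ^ m else 0 := by
  -- The downward recursion divides by `z`; at `z = 0` the Cauchy transform is a mean over the
  -- circle.
  rcases eq_or_ne z 0 with rfl | hz0
  · have h := circleMean_ev (T m)
    rw [T_apply, circleMean] at h
    simp only [ev_T] at h
    simp only [cauchyTransform, sub_zero]
    rw [h]
    by_cases hm : m = 0
    · simp [hm]
    · rw [if_neg hm, zero_zpow _ hm, ite_self]
  · have h0 : cauchyTransform (fun s => s ^ (0 : ℤ)) z = 1 := by
      have := circleIntegral.integral_sub_inv_of_mem_ball (c := 0) (R := 1) (w := z) (by simpa)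
      simp only [cauchyTransform, zpow_zero, one_div, this]
      exact inv_mul_cancel₀ Complex.two_pi_I_ne_zero
    induction m using Int.induction_on with
    | zero => simpa using h0
    | succ n ih =>
      rw [cauchyTransform_zpow_succ hz.ne, ih, if_neg (by omega), if_pos (by omega),
        if_pos (by omega), zero_add, zpow_add_one₀ hz0, mul_comm]
    | pred n ih =>
      have h := cauchyTransform_zpow_succ hz.ne (-(n : ℤ) - 1)
      rw [sub_add_cancel, ih] at h
      rw [if_neg (by omega)]
      refine (mul_eq_zero.mp (?_ : z * _ = 0)).resolve_left hz0
      rcases n with _ | n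
      · simpa using h
      · rw [if_neg (by omega), if_neg (by omega), zero_add] at h
        exact h.symm

theorem cauchyTransform_zpow_outside {z : ℂ} (hz : 1 < ‖z‖) (m : ℤ) :
    cauchyTransform (fun s => s ^ m) z = if 0 ≤ m then 0 else -z ^ m := by
  have hz0 : z ≠ 0 := by
    rintro rfl
    simp at hz
    linarith
  have h0 : cauchyTransform (fun s => s ^ (0 : ℤ)) z = 0 := by
    have hne : ∀ s ∈ Metric.closedBall (0 : ℂ) 1, s - z ≠ 0 := by
      intro s hs h
      rw [sub_eq_zero] at h
      subst h
      simp at hs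
      linarith
    simp only [cauchyTransform, zpow_zero, one_div]
    rw [Complex.circleIntegral_eq_zero_of_differentiable_on_off_countable
      (f := fun s => (s - z)⁻¹) zero_le_one Set.countable_empty (ContinuousOn.inv₀ (by fun_prop) hne), mul_zero]
    intro s hs
    exact (differentiableAt_id.sub_const z).inv (hne s (Metric.ball_subset_closedBall hs.1))
  induction m using Int.induction_on with
  | zero => simpa using h0
  | succ n ih =>
    rw [cauchyTransform_zpow_succ hz.ne', ih, if_neg (by omega), if_pos (by omega),
      if_pos (by omega), zero_add, mul_zero]
  | pred n ih =>
    have h := cauchyTransform_zpow_succ hz.ne' (-(n : ℤ) - 1)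
    rw [sub_add_cancel, ih] at h
    rw [if_neg (by omega)]
    refine mul_left_cancel₀ hz0 ?_
    rw [zpow_sub_one₀ hz0]
    rcases n with _ | n
    · simp at h ⊢
      rw [mul_inv_cancel₀ hz0]
      linear_combination -h
    · rw [if_neg (by omega), if_neg (by omega), zero_add] at h
      rw [← h]
      field_simp

theorem cauchyTransform_ev {z : ℂ} (hz : ‖z‖ ≠ 1) (p : ℂ[T;T⁻¹]) :
    cauchyTransform (ev p) z =
      p.coeff.sum fun m a => a * cauchyTransform (fun s => s ^ m) z := by
  simp only [cauchyTransform, div_eq_mul_inv]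
  rw [circleIntegral_ev_mul (continuousOn_inv_sub hz), Finsupp.mul_sum]
  refine Finset.sum_congr rfl fun m _ => ?_
  ring

theorem cauchyTransform_ev_inside {z : ℂ} (hz : ‖z‖ < 1) (p : ℂ[T;T⁻¹]) :
    cauchyTransform (ev p) z = ev (posPart p) z := by
  rw [cauchyTransform_ev hz.ne, ev_posPart]
  simp only [cauchyTransform_zpow_inside hz]

theorem cauchyTransform_ev_outside {z : ℂ} (hz : 1 < ‖z‖) (p : ℂ[T;T⁻¹]) :
    cauchyTransform (ev p) z = -ev (negPart p) z := by
  rw [cauchyTransform_ev hz.ne', ev_negPart]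
  simp only [cauchyTransform_zpow_outside hz]

theorem eventually_cobounded_lt_norm (r : ℝ) : ∀ᶠ z : ℂ in Bornology.cobounded ℂ, r < ‖z‖ :=
  (tendsto_norm_cobounded_atTop (E := ℂ)).eventually (eventually_gt_atTop r)

theorem isBigO_zpow {m : ℤ} (hm : m ≤ -1) :
    (fun z : ℂ => z ^ m) =O[Bornology.cobounded ℂ] fun z => z⁻¹ := by
  refine IsBigO.of_bound 1 ?_
  filter_upwards [eventually_cobounded_lt_norm 1] with z hz
  rw [one_mul, norm_zpow, norm_inv, ← zpow_neg_one]
  exact zpow_le_zpow_right₀ hz.le hm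

theorem isBigO_ev_sub (p : ℂ[T;T⁻¹]) (d : ℤ) (hp : ∀ m, d < m → p.coeff m = 0) :
    (fun z => ev p z * z ^ (-d) - p.coeff d) =O[Bornology.cobounded ℂ] fun z => z⁻¹ := by
  have h1 : (fun z : ℂ => ∑ m ∈ p.coeff.support.erase d, p.coeff m * z ^ (m - d))
      =O[Bornology.cobounded ℂ] fun z => z⁻¹ := by
    refine IsBigO.fun_sum fun m hm => (isBigO_zpow ?_).const_mul_left _
    obtain ⟨hne, hs⟩ := Finset.mem_erase.mp hm
    have : ¬d < m := fun h => Finsupp.mem_support_iff.mp hs (hp m h)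
    omega
  refine h1.congr' ?_ EventuallyEq.rfl
  filter_upwards [eventually_cobounded_lt_norm 0] with z hz
  have hz0 : z ≠ 0 := norm_pos_iff.mp hz
  have h2 : ev p z * z ^ (-d) = ∑ m ∈ p.coeff.support, p.coeff m * z ^ (m - d) := by
    rw [ev, Finsupp.sum_mul, Finsupp.sum]
    refine Finset.sum_congr rfl fun m _ => ?_
    rw [mul_assoc, ← zpow_add₀ hz0, sub_eq_add_neg]
  rw [h2, eq_sub_iff_add_eq]
  by_cases hd : d ∈ p.coeff.support
  · rw [Finset.sum_erase_eq_sub hd]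
    simp
  · rw [Finset.erase_eq_of_notMem hd, Finsupp.notMem_support_iff.mp hd, add_zero]

end CircleRHP

/-! ### Uniqueness for the Riemann–Hilbert problem. -/

namespace CircleRHP

open scoped Topology

theorem setOf_norm_le_one : {z : ℂ | ‖z‖ ≤ 1} = Metric.closedBall 0 1 := by
  ext z; simp

theorem two_pi_I_inv_smul_circleIntegral {f : ℂ → ℂ} {s : Set ℂ} (hs : s.Countable)
    (hf : ContinuousOn f {z | ‖z‖ ≤ 1}) (hd : ∀ z, ‖z‖ < 1 → z ∉ s → DifferentiableAt ℂ f z)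
    {w : ℂ} (hw : ‖w‖ < 1) :
    (2 * (Real.pi : ℂ) * Complex.I)⁻¹ • (∮ z in C(0, 1), (z - w)⁻¹ • f z) = f w := by
  rw [setOf_norm_le_one] at hf
  refine Complex.two_pi_I_inv_smul_circleIntegral_sub_inv_smul_of_differentiable_on_off_countable
    hs (by simpa using hw) hf fun z hz => hd z (by simpa using hz.1) hz.2

/-- A function on the sphere, analytic off the unit circle, continuous across it, and vanishing
at infinity, vanishes inside the circle. -/
theorem eq_zero_inside {f g : ℂ → ℂ} (hf : ContinuousOn f {z | ‖z‖ ≤ 1})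
    (hfd : ∀ z, ‖z‖ < 1 → DifferentiableAt ℂ f z) (hg : ContinuousOn g {z | 1 ≤ ‖z‖})
    (hgd : ∀ z, 1 < ‖z‖ → DifferentiableAt ℂ g z) (hfg : ∀ z, ‖z‖ = 1 → f z = g z)
    (hlim : Tendsto g (Bornology.cobounded ℂ) (𝓝 0)) {w : ℂ} (hw : ‖w‖ < 1) : f w = 0 := by
  rw [← two_pi_I_inv_smul_circleIntegral Set.countable_empty hf (fun z hz _ => hfd z hz) hw]
  have hne : ∀ z : ℂ, 1 ≤ ‖z‖ → z - w ≠ 0 := by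
    intro z hz h
    rw [sub_eq_zero] at h
    subst h
    linarith
  have hR : ∀ R : ℝ, 1 ≤ R → (∮ z in C(0, 1), (z - w)⁻¹ • f z) =
      ∮ z in C(0, R), (z - w)⁻¹ • g z := by
    intro R hR
    have h1 : (∮ z in C(0, 1), (z - w)⁻¹ • f z) = ∮ z in C(0, 1), (z - w)⁻¹ • g z := by
      refine circleIntegral.integral_congr zero_le_one fun z hz => ?_
      simp only [hfg z (by simpa using hz)]
    rw [h1]
    symm
    refine Complex.circleIntegral_eq_of_differentiable_on_annulus_off_countable zero_lt_one hR
      Set.countable_empty ?_ ?_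
    · refine ContinuousOn.smul (ContinuousOn.inv₀ (by fun_prop) fun z hz => hne z ?_)
        (hg.mono fun z hz => ?_)
      · simpa using hz.2
      · simpa using hz.2
    · intro z hz
      have hz1 : 1 < ‖z‖ := by simpa using hz.1.2
      exact ((differentiableAt_id.sub_const w).inv (hne z hz1.le)).smul (hgd z hz1)
  have hzero : (∮ z in C(0, 1), (z - w)⁻¹ • f z) = 0 := by
    rw [← norm_le_zero_iff]
    refine le_of_forall_pos_le_add fun ε hε => ?_
    have hpi := Real.pi_pos
    -- On `|z| = R` with `R ≥ 2` one has `|z - w| ≥ R / 2`, so the integral is at most `2πR · (2/R)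
    -- · ε/(4π) = ε`.
    have hδ : 0 < ε / (4 * Real.pi) := by positivity
    have hev : ∀ᶠ z in Bornology.cobounded ℂ, ‖g z‖ < ε / (4 * Real.pi) := by
      simpa using hlim.norm.eventually (gt_mem_nhds (by simpa using hδ))
    obtain ⟨r, -, hr⟩ := (Metric.hasBasis_cobounded_compl_closedBall (0 : ℂ)).eventually_iff.mp hev
    obtain ⟨R, hR2, hRr⟩ : ∃ R : ℝ, 2 ≤ R ∧ r < R := ⟨max 2 (r + 1), by simp, by simp⟩
    rw [hR R (by linarith), zero_add]
    refine (circleIntegral.norm_integral_le_of_norm_le_const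
      (C := (R / 2)⁻¹ * (ε / (4 * Real.pi))) (by linarith) fun z hz => ?_).trans ?_
    · have hzR : ‖z‖ = R := by simpa using hz
      rw [norm_smul, norm_inv]
      have h2 : R / 2 ≤ ‖z - w‖ := by
        have := norm_sub_norm_le z w
        linarith
      have h3 : ‖g z‖ < ε / (4 * Real.pi) := hr (by simp [hzR, hRr])
      gcongr
    · have : R ≠ 0 := by linarith
      rw [inv_div]
      apply le_of_eq
      field_simp
      ring
  rw [hzero, smul_zero]

theorem eq_const_of_no_jump {f g : ℂ → ℂ} {c : ℂ} (hf : ContinuousOn f {z | ‖z‖ ≤ 1})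
    (hfd : ∀ z, ‖z‖ < 1 → DifferentiableAt ℂ f z) (hg : ContinuousOn g {z | 1 ≤ ‖z‖})
    (hgd : ∀ z, 1 < ‖z‖ → DifferentiableAt ℂ g z) (hfg : ∀ z, ‖z‖ = 1 → f z = g z)
    (hlim : Tendsto g (Bornology.cobounded ℂ) (𝓝 c)) :
    (∀ z, ‖z‖ < 1 → f z = c) ∧ ∀ z, 1 < ‖z‖ → g z = c := by
  have hin : ∀ z, ‖z‖ < 1 → f z = c := by
    intro z hz
    rw [← sub_eq_zero]
    exact eq_zero_inside (f := fun z => f z - c) (g := fun z => g z - c)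
      (hf.sub continuousOn_const) (fun z hz => (hfd z hz).sub_const c)
      (hg.sub continuousOn_const) (fun z hz => (hgd z hz).sub_const c)
      (fun z hz => by rw [hfg z hz]) (by simpa using hlim.sub_const c) hz
  have hcirc : ∀ z, ‖z‖ = 1 → g z = c := by
    intro z hz
    rw [← hfg z hz]
    have h1 : Set.EqOn f (fun _ => c) (Metric.ball 0 1) := fun z hz => hin z (by simpa using hz)
    rw [setOf_norm_le_one] at hf
    refine h1.of_subset_closure hf continuousOn_const Metric.ball_subset_closedBall ?_
      (show z ∈ Metric.closedBall 0 1 by simp [hz])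
    rw [closure_ball _ one_ne_zero]
  refine ⟨hin, fun z hz => ?_⟩
  -- Inversion moves the exterior to the disc, with `c` as the value at infinity. At `0` only
  -- continuity is known, which Cauchy's formula allows at countably many points; `h` equals `c` on
  -- the circle and hence inside.
  let h : ℂ → ℂ := Function.update (fun w => g w⁻¹) 0 c
  have hne : ∀ w, w ≠ 0 → h =ᶠ[𝓝 w] fun w => g w⁻¹ := fun w hw => by
    filter_upwards [isOpen_ne.mem_nhds hw] with v hv
    exact Function.update_of_ne hv _ _
  have hcont : ContinuousOn h {w | ‖w‖ ≤ 1} := by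
    intro w hw
    rcases eq_or_ne w 0 with rfl | hw0
    · refine ContinuousAt.continuousWithinAt ?_
      rw [continuousAt_update_same]
      exact hlim.comp tendsto_inv₀_nhdsNE_zero
    · have h2 : ContinuousWithinAt (fun w => g w⁻¹) {w | ‖w‖ ≤ 1} w := by
        have hw1 : (1 : ℝ) ≤ ‖w⁻¹‖ := by
          rw [norm_inv]
          exact (one_le_inv₀ (norm_pos_iff.mpr hw0)).mpr hw
        rw [← continuousWithinAt_inter (isOpen_ne.mem_nhds hw0)]
        refine (hg _ hw1).comp (continuousAt_inv₀ hw0).continuousWithinAt fun v hv => ?_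
        rw [Set.mem_ofPred_eq, norm_inv]
        exact (one_le_inv₀ (norm_pos_iff.mpr hv.2)).mpr hv.1
      exact h2.congr_of_eventuallyEq ((hne w hw0).filter_mono nhdsWithin_le_nhds)
        (Function.update_of_ne hw0 _ _)
  have hdiff : ∀ w, ‖w‖ < 1 → w ∉ ({0} : Set ℂ) → DifferentiableAt ℂ h w := by
    intro w hw hw0
    have hw1 : (1 : ℝ) < ‖w⁻¹‖ := by
      rw [norm_inv]
      exact (one_lt_inv₀ (norm_pos_iff.mpr hw0)).mpr hw
    refine DifferentiableAt.congr_of_eventuallyEq ?_ (hne w hw0)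
    exact (hgd _ hw1).comp w (differentiableAt_inv hw0)
  have hz0 : z ≠ 0 := norm_pos_iff.mp (by linarith)
  have hzi : ‖z⁻¹‖ < 1 := by
    rw [norm_inv]
    exact inv_lt_one_of_one_lt₀ hz
  have e1 := two_pi_I_inv_smul_circleIntegral (Set.countable_singleton 0) hcont hdiff hzi
  have e2 := two_pi_I_inv_smul_circleIntegral (f := fun _ => c) Set.countable_empty
    continuousOn_const (fun _ _ _ => differentiableAt_const c) hzi
  have e3 : (∮ w in C(0, 1), (w - z⁻¹)⁻¹ • h w) = ∮ w in C(0, 1), (w - z⁻¹)⁻¹ • c := by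
    refine circleIntegral.integral_congr zero_le_one fun w hw => ?_
    have hw1 : ‖w‖ = 1 := by simpa using hw
    have : h w = c := by
      rw [show h w = g w⁻¹ from Function.update_of_ne (ne_zero_of_mem_sphere hw) _ _]
      exact hcirc _ (by simp [hw1])
    simp only [this]
  rw [e3] at e1
  have e4 : h z⁻¹ = c := e1.symm.trans e2
  rwa [show h z⁻¹ = g z⁻¹⁻¹ from Function.update_of_ne (inv_ne_zero hz0) _ _, inv_inv] at e4

theorem differentiableAt_mul_adjugate {A B : ℂ → Matrix (Fin 2) (Fin 2) ℂ} {z : ℂ}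
    (hA : ∀ i j, DifferentiableAt ℂ (fun z => A z i j) z)
    (hB : ∀ i j, DifferentiableAt ℂ (fun z => B z i j) z) (i j : Fin 2) :
    DifferentiableAt ℂ (fun z => (A z * (B z).adjugate) i j) z := by
  simp only [Matrix.mul_apply, Fin.sum_univ_two, Matrix.adjugate_fin_two]
  fin_cases j <;> simp <;> fun_prop

/-- Used for the jump matrix and for `diagPow`: both have determinant one, so both cancel from `Y'
adj(Y)`. -/
theorem mul_mul_adjugate_mul {J : Matrix (Fin 2) (Fin 2) ℂ} (hJ : J.det = 1)
    (P Q : Matrix (Fin 2) (Fin 2) ℂ) : P * J * (Q * J).adjugate = P * Q.adjugate := by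
  have h : J * J.adjugate = 1 := by rw [Matrix.mul_adjugate, hJ, one_smul]
  rw [Matrix.adjugate_mul_distrib, mul_assoc, ← mul_assoc J, h, one_mul]

variable {t : ℝ} {M N k : ℕ} {Y Y' : ℂ → Matrix (Fin 2) (Fin 2) ℂ}

/-- The normalization factor at infinity. -/
def diagPow (k : ℕ) (z : ℂ) : Matrix (Fin 2) (Fin 2) ℂ := !![z ^ (-(k : ℤ)), 0; 0, z ^ (k : ℤ)]

theorem IsSolution.tendsto (h : IsSolution t M N k Y) :
    Tendsto (fun z => Y z * diagPow k z) (Bornology.cobounded ℂ) (𝓝 1) := by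
  refine tendsto_pi_nhds.mpr fun i => tendsto_pi_nhds.mpr fun j => ?_
  have h1 := (h.normalized i j).trans_tendsto tendsto_inv₀_cobounded
  have h2 := h1.add_const ((1 : Matrix (Fin 2) (Fin 2) ℂ) i j)
  rw [zero_add] at h2
  refine h2.congr fun z => ?_
  rw [Matrix.sub_apply, sub_add_cancel]
  rfl

theorem isOpen_norm_lt_one : IsOpen {z : ℂ | ‖z‖ < 1} := isOpen_lt continuous_norm continuous_const

theorem isOpen_one_lt_norm : IsOpen {z : ℂ | 1 < ‖z‖} := isOpen_lt continuous_const continuous_norm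

/-- The adjugate replaces the inverse: it is polynomial in the entries, hence analytic before `det Y
≠ 0` is known. The case `Y' = Y` then gives `det Y = 1`. -/
theorem IsSolution.mul_adjugate_eq_one (h : IsSolution t M N k Y) (h' : IsSolution t M N k Y')
    {z : ℂ} (hz : z ∈ offCircle) : Y' z * (Y z).adjugate = 1 := by
  obtain ⟨A, B, hA, hAY, hB, hBY, hAB⟩ := h.jump
  obtain ⟨A', B', hA', hAY', hB', hBY', hAB'⟩ := h'.jump
  have hcont : Continuous fun p : Matrix (Fin 2) (Fin 2) ℂ × Matrix (Fin 2) (Fin 2) ℂ =>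
      p.1 * p.2.adjugate := continuous_fst.matrix_mul continuous_snd.matrix_adjugate
  have hd : ∀ z ∈ offCircle, ∀ i j,
      DifferentiableAt ℂ (fun z => (Y' z * (Y z).adjugate) i j) z := fun z hz i j =>
    differentiableAt_mul_adjugate (fun i j => (h'.analytic i j z hz).differentiableAt)
      (fun i j => (h.analytic i j z hz).differentiableAt) i j
  have hlim : Tendsto (fun z => Y' z * (Y z).adjugate) (Bornology.cobounded ℂ) (𝓝 1) := by
    have h1 := (hcont.tendsto _).comp (h'.tendsto.prodMk_nhds h.tendsto)
    rw [Matrix.adjugate_one, mul_one] at h1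
    refine h1.congr' ?_
    filter_upwards [eventually_cobounded_lt_norm 0] with z hz
    have hz0 : z ^ k ≠ 0 := pow_ne_zero _ (norm_pos_iff.mp hz)
    exact mul_mul_adjugate_mul (by simp [diagPow, Matrix.det_fin_two, hz0]) _ _
  have key : ∀ i j, (∀ z, ‖z‖ < 1 → (A' z * (A z).adjugate) i j =
      (1 : Matrix (Fin 2) (Fin 2) ℂ) i j) ∧ ∀ z, 1 < ‖z‖ → (B' z * (B z).adjugate) i j =
      (1 : Matrix (Fin 2) (Fin 2) ℂ) i j := by
    intro i j
    have hent : Continuous fun m : Matrix (Fin 2) (Fin 2) ℂ => m i j :=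
      continuous_id.matrix_elem i j
    have hcomp : ∀ {P Q : ℂ → Matrix (Fin 2) (Fin 2) ℂ} {s : Set ℂ}, ContinuousOn P s →
        ContinuousOn Q s → ContinuousOn (fun z => (P z * (Q z).adjugate) i j) s := fun hP hQ =>
      (hent.comp hcont).comp_continuousOn (hP.prodMk hQ)
    refine eq_const_of_no_jump (f := fun z => (A' z * (A z).adjugate) i j)
      (g := fun z => (B' z * (B z).adjugate) i j) (hcomp hA' hA) ?_ (hcomp hB' hB) ?_ ?_ ?_
    · intro z hz
      refine (hd z hz.ne i j).congr_of_eventuallyEq ?_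
      filter_upwards [isOpen_norm_lt_one.mem_nhds hz] with v hv
      rw [hAY' hv, hAY hv]
    · intro z hz
      refine (hd z hz.ne' i j).congr_of_eventuallyEq ?_
      filter_upwards [isOpen_one_lt_norm.mem_nhds hz] with v hv
      rw [hBY' hv, hBY hv]
    · intro z hz
      simp only [hAB z hz, hAB' z hz]
      rw [mul_mul_adjugate_mul (by simp [Matrix.det_fin_two])]
    · refine Tendsto.congr' ?_ ((hent.tendsto _).comp hlim)
      filter_upwards [eventually_cobounded_lt_norm 1] with v hv
      rw [hBY' hv, hBY hv]
      rfl
  ext i j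
  rcases lt_or_gt_of_ne hz with hz | hz
  · rw [← (key i j).1 z hz, hAY' hz, hAY hz]
  · rw [← (key i j).2 z hz, hBY' hz, hBY hz]

theorem IsSolution.eqOn (h : IsSolution t M N k Y) (h' : IsSolution t M N k Y') :
    Set.EqOn Y' Y offCircle := by
  intro z hz
  have h1 : (Y z).adjugate * Y z = 1 := by
    rw [Matrix.adjugate_mul, ← Matrix.mul_adjugate, h.mul_adjugate_eq_one h hz]
  rw [← mul_one (Y' z), ← h1, ← mul_assoc, h.mul_adjugate_eq_one h' hz, one_mul]

end CircleRHP

/-! ### Orthogonal polynomials and the explicit solution. -/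

namespace CircleRHP

open LaurentPolynomial LastPassage
open scoped Topology NNReal

/-- The weight as a Laurent polynomial. -/
def phiL (t : ℝ) (M N : ℕ) : ℂ[T;T⁻¹] := (1 + C (t : ℂ) * T 1) ^ M * (1 + C (t : ℂ) * T (-1)) ^ N

variable {t : ℝ} {M N : ℕ}

theorem ne_zero_of_norm_eq_one {z : ℂ} (hz : ‖z‖ = 1) : z ≠ 0 :=
  norm_ne_zero_iff.mp (by simp [hz])

theorem ev_phiL {z : ℂ} (hz : z ≠ 0) : ev (phiL t M N) z = phi t M N z := by
  simp only [phiL, phi, ev_mul _ _ hz, ev_pow _ _ hz, ev_add, ev_one, ev_C, ev_T, zpow_one,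
    zpow_neg_one, div_eq_mul_inv]

theorem circleMean_zpow_mul_ev (p : ℂ[T;T⁻¹]) (j : ℤ) :
    circleMean (fun z => z ^ (-j) * ev p z) = p.coeff j := by
  rw [circleMean_congr (g := ev (p * T (-j))), circleMean_ev, coeff_mul_T, zero_sub, neg_neg]
  intro z hz
  rw [ev_mul _ _ (ne_zero_of_norm_eq_one hz), ev_T, mul_comm]

theorem fourierCoeff_eq (j : ℤ) : fourierCoeff t M N j = (phiL t M N).coeff j := by
  rw [fourierCoeff, ← circleMean_zpow_mul_ev]
  refine circleMean_congr fun z hz => ?_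
  rw [ev_phiL (ne_zero_of_norm_eq_one hz)]

theorem toeplitzDet_eq (x : ℝ≥0) (n : ℕ) :
    toeplitzDet x M N n = ((cauchySum x M N n : ℝ) : ℂ) := by
  have h := det_toeplitz_eq_finsum ((x : ℝ) : ℂ) M N n
  simp only [toeplitzDet, fourierCoeff_eq, phiL]
  rw [h]
  let f : ℝ≥0 →+* ℂ := Complex.ofRealHom.comp NNReal.toRealHom
  have hfin : (Function.support fun a : Fin n → ℤ =>
      stripSum x n N a * stripSum x n M a).Finite :=
    (stripSum_support_finite _ n N).subset fun a ha => left_ne_zero_of_mul ha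
  refine Eq.trans ?_ (f.toAddMonoidHom.map_finsum hfin).symm
  refine finsum_congr fun a => ?_
  have h1 : ((x : ℝ) : ℂ) = f x := rfl
  rw [h1, ← map_stripSum f, ← map_stripSum f, ← map_mul]
  rfl

theorem toeplitzDet_ne_zero (ht : 0 ≤ t) (n : ℕ) : toeplitzDet t M N n ≠ 0 := by
  lift t to ℝ≥0 using ht
  rw [toeplitzDet_eq, Complex.ofReal_ne_zero, NNReal.coe_ne_zero]
  exact (zero_lt_one.trans_le (one_le_cauchySum _ M N n)).ne'

theorem normConst_ne_zero (ht : 0 ≤ t) (k : ℕ) : normConst t M N k ≠ 0 :=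
  div_ne_zero (toeplitzDet_ne_zero ht _) (toeplitzDet_ne_zero ht _)

/-- The cofactors along the last row of a matrix whose first `k` rows are `F r`. -/
def lastCofactor (k : ℕ) (F : ℕ → ℕ → ℂ) (c : Fin (k + 1)) : ℂ :=
  (-1) ^ (k + (c : ℕ)) * (Matrix.of fun r j : Fin k => F r (c.succAbove j)).det

/-- The cofactors do not depend on the last row `v`. Powers of `z` in that row give the polynomial,
Fourier coefficients give its moments. -/
theorem det_eq_sum_lastCofactor (k : ℕ) (F : ℕ → ℕ → ℂ) (v : ℕ → ℂ) :
    (Matrix.of fun r c : Fin (k + 1) => if (r : ℕ) < k then F r c else v c).det =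
      ∑ c : Fin (k + 1), lastCofactor k F c * v c := by
  rw [Matrix.det_succ_row _ (Fin.last k)]
  refine Finset.sum_congr rfl fun c _ => ?_
  have hsub : (Matrix.of fun r c : Fin (k + 1) => if (r : ℕ) < k then F r c else v c).submatrix
      (Fin.last k).succAbove c.succAbove = Matrix.of fun r j : Fin k => F r (c.succAbove j) := by
    ext r j
    simp [Fin.succAbove_last]
  rw [hsub, lastCofactor, mul_right_comm]
  simp

theorem lastCofactor_last (k : ℕ) (F : ℕ → ℕ → ℂ) :
    lastCofactor k F (Fin.last k) = (Matrix.of fun r j : Fin k => F r j).det := by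
  rw [lastCofactor, Fin.val_last, Even.neg_one_pow ⟨k, rfl⟩, one_mul]
  congr 1
  ext r j
  simp [Fin.succAbove_last]

/-- The Laurent polynomial with the cofactors as coefficients. -/
def cofactorPoly (k : ℕ) (F : ℕ → ℕ → ℂ) (g : ℕ → ℕ) : ℂ[T;T⁻¹] :=
  ∑ c : Fin (k + 1), C (lastCofactor k F c) * T (g c)

theorem ev_cofactorPoly (k : ℕ) (F : ℕ → ℕ → ℂ) (g : ℕ → ℕ) (z : ℂ) :
    ev (cofactorPoly k F g) z =
      (Matrix.of fun r c : Fin (k + 1) => if (r : ℕ) < k then F r c else z ^ g c).det := by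
  rw [det_eq_sum_lastCofactor k F fun c => z ^ g c, cofactorPoly, ev_sum]
  simp only [ev_C_mul_T, zpow_natCast]

theorem coeff_cofactorPoly (k : ℕ) (F : ℕ → ℕ → ℂ) (g : ℕ → ℕ) (m : ℤ) :
    (cofactorPoly k F g).coeff m =
      ∑ c : Fin (k + 1), if (g c : ℤ) = m then lastCofactor k F c else 0 := by
  rw [cofactorPoly, AddMonoidAlgebra.coeff_sum, Finset.sum_apply']
  refine Finset.sum_congr rfl fun c _ => ?_
  rw [← single_eq_C_mul_T, AddMonoidAlgebra.coeff_single, Finsupp.single_apply]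

theorem coeff_mul_cofactorPoly (p : ℂ[T;T⁻¹]) (k : ℕ) (F : ℕ → ℕ → ℂ) (g : ℕ → ℕ) (j : ℤ) :
    (p * cofactorPoly k F g).coeff j = (Matrix.of fun r c : Fin (k + 1) =>
      if (r : ℕ) < k then F r c else p.coeff (j - g c)).det := by
  rw [det_eq_sum_lastCofactor k F fun c => p.coeff (j - g c), cofactorPoly, Finset.mul_sum,
    AddMonoidAlgebra.coeff_sum, Finset.sum_apply']
  refine Finset.sum_congr rfl fun c _ => ?_
  rw [mul_left_comm, ← smul_eq_C_mul, AddMonoidAlgebra.coeff_smul, Finsupp.smul_apply, coeff_mul_T,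
    smul_eq_mul]

/-- `π_k` as a Laurent polynomial. -/
def orthL (t : ℝ) (M N k : ℕ) : ℂ[T;T⁻¹] := C (toeplitzDet t M N k)⁻¹ *
  cofactorPoly k (fun r c => fourierCoeff t M N ((r : ℤ) - (c : ℤ))) id

/-- `π*_k` as a Laurent polynomial. -/
def orthStarL (t : ℝ) (M N k : ℕ) : ℂ[T;T⁻¹] := C (toeplitzDet t M N k)⁻¹ *
  cofactorPoly k (fun r c => fourierCoeff t M N ((c : ℤ) - (r : ℤ))) fun c => k - c

theorem coeff_C_mul (a : ℂ) (p : ℂ[T;T⁻¹]) (m : ℤ) : (C a * p).coeff m = a * p.coeff m := by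
  rw [← smul_eq_C_mul, AddMonoidAlgebra.coeff_smul, Finsupp.smul_apply, smul_eq_mul]

theorem ev_orthL (k : ℕ) (z : ℂ) : ev (orthL t M N k) z = orthPoly t M N k z := by
  rw [orthL, ev_C_mul, ev_cofactorPoly]
  rfl

theorem ev_orthStarL (k : ℕ) (z : ℂ) : ev (orthStarL t M N k) z = orthPolyStar t M N k z := by
  rw [orthStarL, ev_C_mul, ev_cofactorPoly]
  rfl

theorem coeff_orthL_eq_zero {k : ℕ} {m : ℤ} (hm : m < 0 ∨ k < m) :
    (orthL t M N k).coeff m = 0 := by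
  rw [orthL, coeff_C_mul, coeff_cofactorPoly, Finset.sum_eq_zero, mul_zero]
  intro c _
  have := c.is_lt
  rw [if_neg (by simp only [id]; omega)]

theorem coeff_orthStarL_eq_zero {k : ℕ} {m : ℤ} (hm : m < 0 ∨ k < m) :
    (orthStarL t M N k).coeff m = 0 := by
  rw [orthStarL, coeff_C_mul, coeff_cofactorPoly, Finset.sum_eq_zero, mul_zero]
  intro c _
  have := c.is_lt
  rw [if_neg (by omega)]

theorem coeff_orthL_self (ht : 0 ≤ t) (k : ℕ) : (orthL t M N k).coeff k = 1 := by
  rw [orthL, coeff_C_mul, coeff_cofactorPoly, Finset.sum_eq_single (Fin.last k), if_pos (by simp),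
    lastCofactor_last]
  · exact inv_mul_cancel₀ (toeplitzDet_ne_zero ht k)
  · intro c _ hc
    refine if_neg fun h => hc (Fin.ext ?_)
    simpa using h
  · simp

/-- At `z = 0` only the corner entry of the last row survives, and its cofactor is the transposed
determinant `D_k`. -/
theorem orthPolyStar_zero (ht : 0 ≤ t) (k : ℕ) : orthPolyStar t M N k 0 = 1 := by
  rw [orthPolyStar, det_eq_sum_lastCofactor k
    (fun r c => fourierCoeff t M N ((c : ℤ) - (r : ℤ))) fun c => (0 : ℂ) ^ (k - c),
    Finset.sum_eq_single (Fin.last k), lastCofactor_last]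
  · rw [Fin.val_last, Nat.sub_self, pow_zero, mul_one, ← Matrix.det_transpose]
    exact inv_mul_cancel₀ (toeplitzDet_ne_zero ht k)
  · intro c _ hc
    have h1 := c.is_lt
    have h2 : (c : ℕ) ≠ k := fun h => hc (Fin.ext h)
    rw [zero_pow (by omega), mul_zero]
  · simp

theorem det_repeated_row (k : ℕ) (F : ℕ → ℕ → ℂ) {j : ℕ} (hj : j < k) :
    (Matrix.of fun r c : Fin (k + 1) => if (r : ℕ) < k then F r c else F j c).det = 0 := by
  refine Matrix.det_zero_of_row_eq (i := ⟨j, by omega⟩) (j := Fin.last k) ?_ ?_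
  · exact fun h => hj.ne (Fin.ext_iff.mp h)
  · ext c
    simp [hj]

theorem det_last_row (k : ℕ) (F : ℕ → ℕ → ℂ) :
    (Matrix.of fun r c : Fin (k + 1) => if (r : ℕ) < k then F r c else F k c).det =
      (Matrix.of fun r c : Fin (k + 1) => F r c).det := by
  congr 1
  ext r c
  by_cases h : (r : ℕ) < k
  · simp [h]
  · have : (r : ℕ) = k := by have := r.is_lt; omega
    simp [this]

theorem coeff_phiL_mul_orthL (k j : ℕ) (hj : j ≤ k) :
    (phiL t M N * orthL t M N k).coeff j = if j = k then normConst t M N k else 0 := by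
  rw [orthL, mul_left_comm, coeff_C_mul, coeff_mul_cofactorPoly]
  simp only [← fourierCoeff_eq, id]
  split_ifs with h
  · subst h
    rw [det_last_row j fun r c => fourierCoeff t M N ((r : ℤ) - (c : ℤ)), normConst, div_eq_inv_mul]
    rfl
  · rw [det_repeated_row k (fun r c => fourierCoeff t M N ((r : ℤ) - (c : ℤ))) (by omega), mul_zero]

theorem coeff_phiL_mul_orthStarL (k j : ℕ) (hj : j ≤ k) :
    (phiL t M N * orthStarL t M N k).coeff j = if j = 0 then normConst t M N k else 0 := by
  rw [orthStarL, mul_left_comm, coeff_C_mul, coeff_mul_cofactorPoly]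
  -- The reversed exponents turn the moment of index `j` into row `k - j`: for `j = 0` this is the
  -- missing row that completes `D_{k+1}`, otherwise it repeats an earlier row.
  have hc : ∀ c : Fin (k + 1), (j : ℤ) - ((k - (c : ℕ) : ℕ) : ℤ) =
      ((c : ℕ) : ℤ) - ((k - j : ℕ) : ℤ) := fun c => by
    have := c.is_lt
    omega
  simp only [← fourierCoeff_eq, hc]
  split_ifs with h
  · subst h
    rw [Nat.sub_zero, det_last_row k fun r c => fourierCoeff t M N ((c : ℤ) - (r : ℤ)), normConst,
      div_eq_inv_mul, ← Matrix.det_transpose]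
    rfl
  · rw [det_repeated_row k (fun r c => fourierCoeff t M N ((c : ℤ) - (r : ℤ))) (by omega), mul_zero]

theorem circleMean_orthPoly (k j : ℕ) (hj : j ≤ k) :
    circleMean (fun z => z ^ (-(j : ℤ)) * orthPoly t M N k z * phi t M N z) =
      if j = k then normConst t M N k else 0 := by
  rw [← coeff_phiL_mul_orthL k j hj, ← circleMean_zpow_mul_ev]
  refine circleMean_congr fun z hz => ?_
  have hz0 := ne_zero_of_norm_eq_one hz
  rw [ev_mul _ _ hz0, ev_phiL hz0, ev_orthL]
  ring

theorem circleMean_orthPolyStar (k j : ℕ) (hj : j ≤ k) :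
    circleMean (fun z => z ^ (-(j : ℤ)) * orthPolyStar t M N k z * phi t M N z) =
      if j = 0 then normConst t M N k else 0 := by
  rw [← coeff_phiL_mul_orthStarL k j hj, ← circleMean_zpow_mul_ev]
  refine circleMean_congr fun z hz => ?_
  have hz0 := ne_zero_of_norm_eq_one hz
  rw [ev_mul _ _ hz0, ev_phiL hz0, ev_orthStarL]
  ring

/-- The exponent in the normalization of the `j`-th column at infinity. -/
def colExp (k : ℕ) (j : Fin 2) : ℤ := if j = 0 then k else -k

/-- A piecewise Laurent polynomial matrix with the right jump and the right degrees solves the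
Riemann–Hilbert problem. -/
theorem isSolution_of_laurent {k : ℕ} {Y : ℂ → Matrix (Fin 2) (Fin 2) ℂ}
    (P Q : Matrix (Fin 2) (Fin 2) ℂ[T;T⁻¹])
    (hin : ∀ z, ‖z‖ < 1 → ∀ i j, Y z i j = ev (P i j) z)
    (hout : ∀ z, 1 < ‖z‖ → ∀ i j, Y z i j = ev (Q i j) z)
    (hP : ∀ i j, ∀ m < 0, (P i j).coeff m = 0)
    (hjump0 : ∀ i, P i 0 = Q i 0)
    (hjump1 : ∀ i, P i 1 = Q i 0 * (T (-k) * phiL t M N) + Q i 1)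
    (hdeg : ∀ i j m, colExp k j < m → (Q i j).coeff m = 0)
    (hlead : ∀ i j, (Q i j).coeff (colExp k j) = if i = j then 1 else 0) :
    IsSolution t M N k Y where
  analytic i j z hz := by
    rcases lt_or_gt_of_ne hz with hz | hz
    · have h : DifferentiableOn ℂ (ev (P i j)) {z | ‖z‖ < 1} :=
        (differentiable_ev _ (hP i j)).differentiableOn
      refine (h.analyticAt (isOpen_norm_lt_one.mem_nhds hz)).congr ?_
      filter_upwards [isOpen_norm_lt_one.mem_nhds hz] with v hv
      exact (hin v hv i j).symm
    · have h : DifferentiableOn ℂ (ev (Q i j)) {z | 1 < ‖z‖} := fun z hz =>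
        (differentiableAt_ev _ (norm_pos_iff.mp (zero_lt_one.trans hz))).differentiableWithinAt
      refine (h.analyticAt (isOpen_one_lt_norm.mem_nhds hz)).congr ?_
      filter_upwards [isOpen_one_lt_norm.mem_nhds hz] with v hv
      exact (hout v hv i j).symm
  jump := by
    refine ⟨fun z => Matrix.of fun i j => ev (P i j) z, fun z => Matrix.of fun i j => ev (Q i j) z,
      ?_, ?_, ?_, ?_, ?_⟩
    · refine continuousOn_pi.mpr fun i => continuousOn_pi.mpr fun j => ?_
      exact (differentiable_ev _ (hP i j)).continuous.continuousOn
    · exact fun z hz => Matrix.ext fun i j => (hin z hz i j).symm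
    · refine continuousOn_pi.mpr fun i => continuousOn_pi.mpr fun j => fun z hz => ?_
      exact (differentiableAt_ev _
        (norm_pos_iff.mp (zero_lt_one.trans_le hz))).continuousAt.continuousWithinAt
    · exact fun z hz => Matrix.ext fun i j => (hout z hz i j).symm
    · intro z hz
      have hz0 := ne_zero_of_norm_eq_one hz
      ext i j
      fin_cases j
      · simp [Matrix.mul_apply, Fin.sum_univ_two, hjump0]
      · simp [Matrix.mul_apply, Fin.sum_univ_two, hjump1, ev_add, ev_mul _ _ hz0, ev_T, ev_phiL hz0,
          mul_comm]
  normalized i j := by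
    have h := isBigO_ev_sub (Q i j) (colExp k j) (hdeg i j)
    refine h.congr' ?_ EventuallyEq.rfl
    filter_upwards [eventually_cobounded_lt_norm 1] with z hz
    rw [← hout z hz, hlead]
    fin_cases i <;> fin_cases j <;>
      simp [Matrix.mul_apply, Fin.sum_univ_two, colExp]

/-- The jump, times the first column, of the orthogonal polynomial solution. -/
theorem cauchyTransform_weight {p : ℂ[T;T⁻¹]} {f : ℂ → ℂ} (hf : ∀ z, ev p z = f z) (k : ℕ) (z : ℂ) :
    cauchyTransform (fun s => s ^ (-(k : ℤ)) * phi t M N s * f s) z =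
      cauchyTransform (ev (p * (T (-k) * phiL t M N))) z := by
  refine cauchyTransform_congr (fun s hs => ?_) z
  have hs0 := ne_zero_of_norm_eq_one hs
  rw [ev_mul _ _ hs0, ev_mul _ _ hs0, ev_T, ev_phiL hs0, hf]
  ring

theorem coeff_mul_weight (p : ℂ[T;T⁻¹]) (k : ℕ) (m : ℤ) :
    (p * (T (-k) * phiL t M N)).coeff m = (phiL t M N * p).coeff (m + k) := by
  have : p * (T (-k) * phiL t M N) = phiL t M N * p * T (-k) := by ring
  rw [this, coeff_mul_T, sub_neg_eq_add]

theorem coeff_neg (p : ℂ[T;T⁻¹]) (m : ℤ) : (-p).coeff m = -p.coeff m := by simp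

theorem coeff_one (m : ℤ) : (1 : ℂ[T;T⁻¹]).coeff m = if m = 0 then 1 else 0 := by
  rw [← T_zero, T_apply]
  simp only [eq_comm]

/-- A first column of polynomials with the right orthogonality relations determines a solution. -/
theorem isSolution_of_column {k : ℕ} {Y : ℂ → Matrix (Fin 2) (Fin 2) ℂ} (hk : 1 ≤ k)
    (p : Fin 2 → ℂ[T;T⁻¹]) (hY0 : ∀ z i, Y z i 0 = ev (p i) z)
    (hY1 : ∀ z i, Y z i 1 = cauchyTransform (ev (p i * (T (-k) * phiL t M N))) z)
    (hneg : ∀ i, ∀ m < 0, (p i).coeff m = 0) (hdeg : ∀ i (m : ℤ), k < m → (p i).coeff m = 0)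
    (hlead : ∀ i, (p i).coeff k = if i = 0 then 1 else 0)
    (horth : ∀ i, ∀ m : ℕ, 1 ≤ m → m < k → (phiL t M N * p i).coeff m = 0)
    (horth0 : ∀ i, (phiL t M N * p i).coeff 0 = if i = 0 then 0 else -1) :
    IsSolution t M N k Y := by
  refine isSolution_of_laurent
    (fun i j => if j = 0 then p i else posPart (p i * (T (-k) * phiL t M N)))
    (fun i j => if j = 0 then p i else -negPart (p i * (T (-k) * phiL t M N)))
    (fun z hz i j => ?_) (fun z hz i j => ?_) (fun i j m hm => ?_) (fun i => rfl) (fun i => ?_)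
    (fun i j m hm => ?_) fun i j => ?_
  · by_cases hj : j = 0
    · rw [hj, hY0, if_pos rfl]
    · rw [if_neg hj, Fin.eq_one_of_ne_zero j hj, hY1, cauchyTransform_ev_inside hz]
  · by_cases hj : j = 0
    · rw [hj, hY0, if_pos rfl]
    · rw [if_neg hj, Fin.eq_one_of_ne_zero j hj, hY1, cauchyTransform_ev_outside hz, ev_neg]
  · by_cases hj : j = 0
    · rw [if_pos hj, hneg i m hm]
    · rw [if_neg hj, coeff_posPart, if_neg (by omega)]
  · simp only [one_ne_zero, if_false, if_true]
    exact eq_add_neg_of_add_eq (posPart_add_negPart _)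
  · by_cases hj : j = 0
    · rw [colExp, if_pos hj] at hm
      rw [if_pos hj, hdeg i m hm]
    · rw [colExp, if_neg hj] at hm
      rw [if_neg hj, coeff_neg, coeff_negPart, neg_eq_zero]
      split_ifs with h0
      · rfl
      -- For `-k < m < 0` the coefficient is the moment of index `m + k`, between `1` and `k - 1`;
      -- the leading coefficient, at `m = -k`, is minus the moment of index `0`.
      · obtain ⟨j, hj⟩ := Int.eq_ofNat_of_zero_le (show 0 ≤ m + k by omega)
        rw [coeff_mul_weight, hj, horth i j (by omega) (by omega)]
  · by_cases hj : j = 0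
    · rw [if_pos hj, colExp, if_pos hj, hlead, hj]
    · have h1 : (i = j) = ¬i = 0 := by
        rw [Fin.eq_one_of_ne_zero j hj]
        fin_cases i <;> simp
      rw [if_neg hj, colExp, if_neg hj, coeff_neg, coeff_negPart, if_neg (by omega),
        coeff_mul_weight, neg_add_cancel, horth0]
      simp only [h1, ite_not]
      split_ifs <;> simp

/-- The moments of `π_k` vanish for indices `0, …, k - 1`. Those of `π*_{k-1}` vanish for `1, …, k -
1`, and the factor `-1 / N_{k-1}` makes the one of index `0` equal to `-1`. -/
theorem isSolution_orthMatrix (ht : 0 ≤ t) {k : ℕ} (hk : 1 ≤ k) :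
    IsSolution t M N k (orthMatrix t M N k) := by
  obtain ⟨l, rfl⟩ := Nat.exists_eq_add_of_le' hk
  have hstar : ∀ (q : ℂ[T;T⁻¹]) (m : ℤ),
      (q * (C (-(normConst t M N l)⁻¹) * orthStarL t M N l)).coeff m =
        -(normConst t M N l)⁻¹ * (q * orthStarL t M N l).coeff m := fun q m => by
    rw [mul_left_comm, coeff_C_mul]
  refine isSolution_of_column hk
    (fun i => if i = 0 then orthL t M N (l + 1) else C (-(normConst t M N l)⁻¹) * orthStarL t M N l)
    (fun z i => ?_) (fun z i => ?_) (fun i m hm => ?_) (fun i m hm => ?_) (fun i => ?_)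
    (fun i m hm1 hm2 => ?_) fun i => ?_
  · by_cases hi : i = 0
    · rw [if_pos hi, hi, ev_orthL]
      simp [orthMatrix]
    · rw [if_neg hi, Fin.eq_one_of_ne_zero i hi, ev_C_mul, ev_orthStarL]
      simp [orthMatrix]
  · by_cases hi : i = 0
    · rw [if_pos hi, hi, ← cauchyTransform_weight (ev_orthL (l + 1))]
      simp [orthMatrix]
    · rw [if_neg hi, Fin.eq_one_of_ne_zero i hi, ← cauchyTransform_weight
        (f := fun s => -(normConst t M N l)⁻¹ * orthPolyStar t M N l s)
        (fun z => by rw [ev_C_mul, ev_orthStarL])]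
      simp only [mul_left_comm _ (-(normConst t M N l)⁻¹), cauchyTransform, mul_div_assoc]
      rw [circleIntegral.integral_const_mul, mul_left_comm]
      simp [orthMatrix, cauchyTransform, mul_div_assoc]
  · split_ifs with hi
    · exact coeff_orthL_eq_zero (Or.inl hm)
    · rw [coeff_C_mul, coeff_orthStarL_eq_zero (Or.inl hm), mul_zero]
  · split_ifs with hi
    · exact coeff_orthL_eq_zero (Or.inr hm)
    · rw [coeff_C_mul, coeff_orthStarL_eq_zero (Or.inr (by omega)), mul_zero]
  · split_ifs with hi
    · exact coeff_orthL_self ht (l + 1)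
    · rw [coeff_C_mul, coeff_orthStarL_eq_zero (Or.inr (by omega)), mul_zero]
  · split_ifs with hi
    · rw [coeff_phiL_mul_orthL _ _ hm2.le, if_neg hm2.ne]
    · rw [hstar, coeff_phiL_mul_orthStarL _ _ (by omega), if_neg (by omega), mul_zero]
  · split_ifs with hi
    · have h := coeff_phiL_mul_orthL (t := t) (M := M) (N := N) (l + 1) 0 (by omega)
      rwa [if_neg (by omega), Nat.cast_zero] at h
    · have h := coeff_phiL_mul_orthStarL (t := t) (M := M) (N := N) l 0 (by omega)
      rw [if_pos rfl, Nat.cast_zero] at h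
      rw [hstar, h, neg_mul, inv_mul_cancel₀ (normConst_ne_zero ht l)]

/-- For `k = 0` the normalization is plain decay to `I`, and splitting `φ` additively into its two
parts removes the jump. -/
theorem exists_isSolution_zero : ∃ Y, IsSolution t M N 0 Y := by
  refine ⟨fun z => !![1, cauchyTransform (ev (phiL t M N)) z; 0, 1],
    isSolution_of_laurent !![1, posPart (phiL t M N); 0, 1] !![1, -negPart (phiL t M N); 0, 1]
    ?_ ?_ ?_ ?_ ?_ ?_ ?_⟩
  · intro z hz i j
    fin_cases i <;> fin_cases j <;> simp [ev_one, ev_zero, cauchyTransform_ev_inside hz]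
  · intro z hz i j
    fin_cases i <;> fin_cases j <;> simp [ev_one, ev_zero, ev_neg, cauchyTransform_ev_outside hz]
  · intro i j m hm
    fin_cases i <;> fin_cases j <;> simp [coeff_posPart, coeff_one] <;> omega
  · intro i
    fin_cases i <;> simp
  · intro i
    fin_cases i
    · simpa using eq_add_neg_of_add_eq (posPart_add_negPart (phiL t M N))
    · simp
  · intro i j m hm
    fin_cases i <;> fin_cases j <;> simp [colExp, coeff_negPart, coeff_one] at hm ⊢ <;> omega
  · intro i j
    fin_cases i <;> fin_cases j <;> simp [colExp, coeff_negPart]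

theorem exists_isSolution (ht : 0 ≤ t) (k : ℕ) : ∃ Y, IsSolution t M N k Y := by
  rcases Nat.eq_zero_or_pos k with rfl | hk
  · exact exists_isSolution_zero
  · exact ⟨_, isSolution_orthMatrix ht hk⟩

theorem orthMatrix_one_zero (ht : 0 ≤ t) (k : ℕ) :
    -(orthMatrix t M N (k + 1) 0 1 0) = toeplitzDet t M N k / toeplitzDet t M N (k + 1) := by
  simp [orthMatrix, orthPolyStar_zero ht, normConst]

end CircleRHP

/-! ### The product formula. -/

open scoped Topology NNReal ENNReal

namespace LastPassage

variable {Ω : Type*} [MeasurableSpace Ω] {μ : Measure Ω} {w : ℕ × ℕ → Ω → ℕ}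

theorem IsGeometricEnvironment.measureReal_G_le [IsProbabilityMeasure μ] {x : ℝ≥0}
    (hw : IsGeometricEnvironment μ x w) (hx : x ≤ 1) (M N n : ℕ) :
    μ.real {ω | G (fun p => w p ω) M N ≤ n} =
      (1 - (x : ℝ) ^ 2) ^ (M * N) * (cauchySum x M N n : ℝ) := by
  have h : 0 ≤ 1 - (x : ℝ) ^ 2 := sub_nonneg.mpr (pow_le_one₀ x.coe_nonneg hx)
  rw [measureReal_def, hw.measure_G_le x.coe_nonneg hx, ENNReal.ofReal_coe_nnreal,
    tsum_schur_mul_schur, ENNReal.toReal_mul, ENNReal.toReal_pow, ENNReal.toReal_ofReal h,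
    ENNReal.coe_toReal]

theorem tendsto_measureReal_G_le [IsProbabilityMeasure μ] (w : ℕ × ℕ → Ω → ℕ) (M N : ℕ) :
    Tendsto (fun n => μ.real {ω | G (fun p => w p ω) M N ≤ n}) atTop (𝓝 1) := by
  have hmono : Monotone fun n => {ω | G (fun p => w p ω) M N ≤ n} :=
    fun a b hab ω (hω : _ ≤ a) => hω.trans hab
  have h := tendsto_measure_iUnion_atTop (μ := μ) hmono
  have hU : ⋃ n, {ω | G (fun p => w p ω) M N ≤ n} = Set.univ :=
    Set.eq_univ_of_forall fun ω => Set.mem_iUnion.mpr ⟨_, le_refl (G (fun p => w p ω) M N)⟩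
  rw [hU, measure_univ] at h
  exact (ENNReal.tendsto_toReal ENNReal.one_ne_top).comp h

end LastPassage

/-- `HasProd` is a limit over all finite sets, not only initial segments. As the factors lie in `[0,
1]`, finite products decrease with the set and converge to their infimum, which the telescoping
products `p 0 / p m` identify. -/
theorem hasProd_div_succ {p : ℕ → ℝ} (hpos : ∀ n, 0 < p n) (hmono : Monotone p)
    (hlim : Tendsto p atTop (𝓝 1)) : HasProd (fun i => p i / p (i + 1)) (p 0) := by
  have h0 : ∀ i, 0 ≤ p i / p (i + 1) := fun i => (div_pos (hpos _) (hpos _)).le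
  have h1 : ∀ i, p i / p (i + 1) ≤ 1 := fun i =>
    (div_le_one (hpos _)).mpr (hmono (Nat.le_succ i))
  have hanti : Antitone fun s : Finset ℕ => ∏ i ∈ s, p i / p (i + 1) := by
    intro s u hsu
    simp only
    rw [← Finset.prod_sdiff hsu]
    exact mul_le_of_le_one_left (Finset.prod_nonneg fun i _ => h0 i)
      (Finset.prod_le_one (fun i _ => h0 i) fun i _ => h1 i)
  have hrange : ∀ m, ∏ i ∈ Finset.range m, p i / p (i + 1) = p 0 / p m := by
    intro m
    induction m with
    | zero => simp [(hpos 0).ne']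
    | succ m ih =>
      rw [Finset.prod_range_succ, ih, div_mul_div_cancel₀ (hpos m).ne']
  have hle : ∀ m, p m ≤ 1 := hmono.ge_of_tendsto hlim
  have hglb : IsGLB (Set.range fun s : Finset ℕ => ∏ i ∈ s, p i / p (i + 1)) (p 0) := by
    constructor
    · rintro _ ⟨s, rfl⟩
      obtain ⟨m, hm⟩ := s.exists_nat_subset_range
      refine le_trans ?_ (hanti hm)
      simp only [hrange]
      exact le_div_self (hpos 0).le (hpos m) (hle m)
    · intro b hb
      have hb' : ∀ m, b ≤ p 0 / p m := fun m => by
        rw [← hrange]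
        exact hb ⟨Finset.range m, rfl⟩
      have hl : Tendsto (fun m => p 0 / p m) atTop (𝓝 (p 0)) := by
        have h := (tendsto_const_nhds (x := p 0)).div hlim one_ne_zero
        rwa [div_one] at h
      exact ge_of_tendsto' hl hb'
  have := tendsto_atTop_isGLB hanti hglb
  rwa [HasProd, SummationFilter.unconditional_filter]

namespace CircleRHP

open LastPassage

theorem hasProd_neg_solution {Ω : Type*} [MeasurableSpace Ω] {μ : Measure Ω}
    [IsProbabilityMeasure μ] {w : ℕ × ℕ → Ω → ℕ} {x : ℝ≥0} (hx : x < 1)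
    (hw : IsGeometricEnvironment μ x w) {M N : ℕ} {Y : ℕ → ℂ → Matrix (Fin 2) (Fin 2) ℂ}
    (hY : ∀ k : ℕ, 1 ≤ k → IsSolution x M N k (Y k)) (n : ℕ) :
    HasProd (fun i : ℕ => -(Y (n + i + 1) 0 1 0))
      ((μ.real {ω | G (fun p => w p ω) M N ≤ n} : ℝ) : ℂ) := by
  set p : ℕ → ℝ := fun m => μ.real {ω | G (fun q => w q ω) M N ≤ m} with hp
  have hc : 0 < (1 - (x : ℝ) ^ 2) ^ (M * N) :=
    pow_pos (sub_pos.mpr (pow_lt_one₀ x.coe_nonneg hx two_ne_zero)) _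
  have hpD : ∀ m, p m = (1 - (x : ℝ) ^ 2) ^ (M * N) * (cauchySum x M N m : ℝ) :=
    hw.measureReal_G_le hx.le M N
  have hD : ∀ m, 0 < (cauchySum x M N m : ℝ) := fun m =>
    NNReal.coe_pos.mpr (zero_lt_one.trans_le (one_le_cauchySum x M N m))
  have hmono : Monotone p := fun a b hab => measureReal_mono fun ω (hω : _ ≤ a) => hω.trans hab
  have hlim := (tendsto_add_atTop_iff_nat n).mpr (tendsto_measureReal_G_le (μ := μ) w M N)
  have h := hasProd_div_succ (p := fun i => p (i + n))
    (fun i => hpD (i + n) ▸ mul_pos hc (hD _)) (fun a b hab => hmono (by omega)) hlim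
  have h2 := h.map Complex.ofRealHom Complex.continuous_ofReal
  simp only [zero_add] at h2
  refine HasProd.congr_fun h2 fun i => ?_
  have hzero : (0 : ℂ) ∈ offCircle := by simp [offCircle]
  -- By uniqueness any solution may be replaced by the explicit one at `z = 0`; the constant `(1 -
  -- x²)^(MN)` then cancels from the ratio of probabilities.
  rw [(isSolution_orthMatrix x.coe_nonneg (Nat.le_add_left 1 (n + i))).eqOn (hY (n + i + 1)
    (Nat.le_add_left _ _)) hzero, orthMatrix_one_zero x.coe_nonneg, toeplitzDet_eq, toeplitzDet_eq]
  simp only [Function.comp_apply, Complex.ofRealHom_eq_coe, hpD]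
  rw [mul_div_mul_left _ _ hc.ne', show i + 1 + n = n + i + 1 by omega, add_comm i n]
  push_cast
  rfl

end CircleRHP

end

theorem lemma2p1 (t : ℝ) (ht0 : 0 < t) (ht1 : t < 1) (M N : ℕ) (hM : 1 ≤ M) (hN : 1 ≤ N) :
    -- existence and uniqueness (as a function on the complement of the circle)
    (∀ k : ℕ, ∃ Y : ℂ → Matrix (Fin 2) (Fin 2) ℂ, CircleRHP.IsSolution t M N k Y ∧
      ∀ Y' : ℂ → Matrix (Fin 2) (Fin 2) ℂ, CircleRHP.IsSolution t M N k Y' →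
        Set.EqOn Y' Y CircleRHP.offCircle) ∧
    -- the orthogonal polynomials are well defined and orthogonal
    (∀ k : ℕ, CircleRHP.toeplitzDet t M N k ≠ 0 ∧
      ∀ j : ℕ, j ≤ k →
        CircleRHP.circleMean
            (fun z => z ^ (-(j : ℤ)) * CircleRHP.orthPoly t M N k z * CircleRHP.phi t M N z) =
          (if j = k then CircleRHP.normConst t M N k else 0) ∧
        CircleRHP.circleMean
            (fun z => z ^ (-(j : ℤ)) * CircleRHP.orthPolyStar t M N k z *
              CircleRHP.phi t M N z) =
          (if j = 0 then CircleRHP.normConst t M N k else 0)) ∧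
    -- the solution is built from them
    (∀ k : ℕ, 1 ≤ k → CircleRHP.IsSolution t M N k (CircleRHP.orthMatrix t M N k)) ∧
    -- the product formula
    (∀ (Ω : Type*) [MeasurableSpace Ω] (μ : Measure Ω) [IsProbabilityMeasure μ]
      (w : ℕ × ℕ → Ω → ℕ), LastPassage.IsGeometricEnvironment μ t w →
      ∀ Y : ℕ → ℂ → Matrix (Fin 2) (Fin 2) ℂ,
        (∀ k : ℕ, 1 ≤ k → CircleRHP.IsSolution t M N k (Y k)) →
        ∀ n : ℕ, HasProd (fun i : ℕ => -(Y (n + i + 1) 0 1 0))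
          ((μ.real {ω | LastPassage.G (fun p => w p ω) M N ≤ n} : ℝ) : ℂ)) := by
  lift t to NNReal using ht0.le
  have hx : t < 1 := ht1
  refine ⟨fun k => ?_, fun k => ⟨CircleRHP.toeplitzDet_ne_zero t.coe_nonneg k, fun j hj =>
    ⟨CircleRHP.circleMean_orthPoly k j hj, CircleRHP.circleMean_orthPolyStar k j hj⟩⟩,
    fun k hk => CircleRHP.isSolution_orthMatrix t.coe_nonneg hk, ?_⟩
  · obtain ⟨Y, hY⟩ := CircleRHP.exists_isSolution (M := M) (N := N) t.coe_nonneg k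
    exact ⟨Y, hY, fun Y' hY' => hY.eqOn hY'⟩
  · intro Ω _ μ _ w hw Y hY n
    exact CircleRHP.hasProd_neg_solution hx hw hY n
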